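/- For every $n\ge 1$ let $K_n$ be an irreducible stochastic matrix on a finite set $\mathcal X_n$ with at least two elements, with symmetric support: $K_n(x,y)>0 \Rightarrow K_n(y,x)>0$ for all $x,y\in\mathcal X_n$. For a matrix $K$ of this kind on a set $\mathcal X$, let $\pi$ be its unique stationary probability vector, $P_t(x,y)=e^{-t}\sum_{k\ge 0}K^k(x,y)\,t^k/k!$ the associated continuous-time semigroup, $d_{\mathrm{TV}}(t)=\max_{o\in\mathcal X}\frac12\sum_{x}|P_t(o,x)-\pi(x)|$ the worst-case total variation distance to equilibrium, and, for $\varepsilon\in(0,1)$, $t_{\mathrm{mix}}(\varepsilon)=\min\{t\ge 0: d_{\mathrm{TV}}(t)\le\varepsilon\}$ the mixing time. Let $$V_{\mathrm{KL}}(t)=\max_{o\in\mathcal X}\operatorname{Var}_{P_t(o,\cdot)}\Big(\log\frac{P_t(o,\cdot)}{\pi}\Big)$$ be the worst-case varentropy at time $t\ge 0$. Let $\delta(K)$ be the smallest nonzero entry of $K$, and let $\gamma(K)$ be the Poincaré constant, i.e. the largest $\gamma$ such that $\gamma\operatorname{Var}_\pi(f)\le\frac12\sum_{x,y}\pi(x)K(x,y)(f(x)-f(y))^2$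 for all $f:\mathcal X\to\mathbb R$. Write $t_{\mathrm{mix}}^{(n)}$ and $V_{\mathrm{KL}}^{(n)}$ for these quantities when $K=K_n$. Assume - (sparsity) $\inf_{n\ge1}\delta(K_n)>0$; - (expansion) $\inf_{n\ge1}\gamma(K_n)>0$. Then the sequence $(K_n)_{n\ge1}$ exhibits cutoff, i.e. $$\frac{t_{\mathrm{mix}}^{(n)}(\varepsilon')}{t_{\mathrm{mix}}^{(n)}(\varepsilon)}\xrightarrow[n\to\infty]{}1\qquad\text{for all }\varepsilon,\varepsilon'\in(0,1),$$ if and only if the varentropy criterion holds: $$\frac{\gamma(K_n)\,t_{\mathrm{mix}}^{(n)}(\varepsilon)}{1+\sqrt{V_{\mathrm{KL}}^{(n)}\big(t_{\mathrm{mix}}^{(n)}(\varepsilon)\big)}}\xrightarrow[n\to\infty]{}+\infty\qquad\text{for every fixed }\varepsilon\in(0,1).$$ -/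

import Mathlib

open Filter Topology

noncomputable section

namespace MarkovCutoff

variable {X : Type*} [Fintype X] [DecidableEq X]

/-- `π` is a stationary probability vector of `K`: nonnegative, of total mass one, `π K = π`. -/
def IsStationary (K : Matrix X X ℝ) (π : X → ℝ) : Prop :=
  π ∈ stdSimplex ℝ X ∧ Matrix.vecMul π K = π

/-- The absolute value of a left fixed vector of a stochastic matrix is a left fixed vector. -/
theorem abs_vecMul_eq {K : Matrix X X ℝ} (hK : K ∈ Matrix.rowStochastic ℝ X) {v : X → ℝ}
    (hv : Matrix.vecMul v K = v) : Matrix.vecMul (fun x => |v x|) K = fun x => |v x| := by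
  have hle : ∀ y ∈ Finset.univ, |v y| ≤ Matrix.vecMul (fun x => |v x|) K y := by
    intro y _
    have h1 : v y = ∑ x, v x * K x y := (congrFun hv y).symm
    calc |v y| = |∑ x, v x * K x y| := by rw [← h1]
      _ ≤ ∑ x, |v x * K x y| := Finset.abs_sum_le_sum_abs _ _
      _ = ∑ x, |v x| * K x y := by
          refine Finset.sum_congr rfl fun x _ => ?_
          rw [abs_mul, abs_of_nonneg (hK.1 x y)]
  have hsum : ∑ y, |v y| = ∑ y, Matrix.vecMul (fun x => |v x|) K y := by
    change _ = ∑ y, ∑ x, |v x| * K x y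
    rw [Finset.sum_comm]
    refine Finset.sum_congr rfl fun x _ => ?_
    rw [← Finset.mul_sum, Matrix.sum_row_of_mem_rowStochastic hK x, mul_one]
  funext y
  exact ((Finset.sum_eq_sum_iff_of_le hle).1 hsum y (Finset.mem_univ y)).symm

/-- A stochastic matrix on a nonempty finite set has a stationary probability vector. -/
theorem exists_isStationary [Nonempty X] {K : Matrix X X ℝ}
    (hK : K ∈ Matrix.rowStochastic ℝ X) : ∃ π, IsStationary K π := by
  have h1 : (K - 1).det = 0 := by
    refine Matrix.exists_mulVec_eq_zero_iff.1 ⟨1, one_ne_zero, ?_⟩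
    rw [Matrix.sub_mulVec, hK.2, Matrix.one_mulVec, sub_self]
  obtain ⟨v, hv0, hv⟩ := Matrix.exists_vecMul_eq_zero_iff.2 h1
  rw [Matrix.vecMul_sub, Matrix.vecMul_one, sub_eq_zero] at hv
  have hpos : 0 < ∑ x, |v x| := by
    obtain ⟨x, hx⟩ := Function.ne_iff.1 hv0
    exact Finset.sum_pos' (fun y _ => abs_nonneg (v y)) ⟨x, Finset.mem_univ x, abs_pos.2 hx⟩
  refine ⟨(∑ x, |v x|)⁻¹ • fun x => |v x|, ⟨fun x => ?_, ?_⟩, ?_⟩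
  · exact mul_nonneg (inv_nonneg.2 hpos.le) (abs_nonneg (v x))
  · simp only [Pi.smul_apply, smul_eq_mul, ← Finset.mul_sum]
    exact inv_mul_cancel₀ hpos.ne'
  · rw [Matrix.smul_vecMul, abs_vecMul_eq hK hv]

/-- An irreducible stochastic matrix has exactly one stationary probability vector. -/
theorem existsUnique_isStationary [Nonempty X] {K : Matrix X X ℝ}
    (hK : K ∈ Matrix.rowStochastic ℝ X) (hirr : K.IsIrreducible) : ∃! π, IsStationary K π := by
  obtain ⟨π, hπ⟩ := exists_isStationary hK
  refine ⟨π, hπ, fun ρ hρ => ?_⟩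
  set u : X → ℝ := ρ - π with hu
  have hfix : Matrix.vecMul u K = u := by rw [hu, Matrix.sub_vecMul, hρ.2, hπ.2]
  have hsum : ∑ x, u x = 0 := by
    simp only [hu, Pi.sub_apply, Finset.sum_sub_distrib, hρ.1.2, hπ.1.2, sub_self]
  set w : X → ℝ := (fun x => |u x|) + u with hw
  have hwfix : Matrix.vecMul w K = w := by
    rw [hw, Matrix.add_vecMul, abs_vecMul_eq hK hfix, hfix]
  have hwpow : ∀ k : ℕ, Matrix.vecMul w (K ^ k) = w := by
    intro k
    induction k with
    | zero => simp
    | succ k ih => rw [pow_succ, ← Matrix.vecMul_vecMul, ih, hwfix]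
  have hw0 : ∀ x, 0 ≤ w x := fun x => by
    have := neg_abs_le (u x)
    simp only [hw, Pi.add_apply]
    linarith
  have hle : ∀ x, u x ≤ 0 := by
    by_contra hcon
    push Not at hcon
    obtain ⟨x, hx⟩ := hcon
    have hwx : 0 < w x := by
      simp only [hw, Pi.add_apply]
      have := abs_nonneg (u x)
      linarith
    have hall : ∀ y ∈ Finset.univ, 0 < u y := by
      intro y _
      obtain ⟨k, -, hk⟩ := (Matrix.isIrreducible_iff_exists_pow_pos hK.1).1 hirr x y
      have hKk : ∀ z, 0 ≤ (K ^ k) z y := fun z => Matrix.pow_apply_nonneg hK.1 k z y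
      have hwy : 0 < w y := by
        rw [← hwpow k]
        exact Finset.sum_pos' (fun z _ => mul_nonneg (hw0 z) (hKk z))
          ⟨x, Finset.mem_univ x, mul_pos hwx hk⟩
      by_contra hneg
      simp only [hw, Pi.add_apply, abs_of_nonpos (not_lt.1 hneg)] at hwy
      linarith
    exact absurd hsum (Finset.sum_pos hall Finset.univ_nonempty).ne'
  funext x
  have := (Finset.sum_eq_zero_iff_of_nonpos (fun x _ => hle x)).1 hsum x (Finset.mem_univ x)
  simp only [hu, Pi.sub_apply] at this
  linarith

/-- The stationary probability vector of `K`, the one solution of `π K = π` when `K` is an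
irreducible stochastic matrix (`stationary_spec`, `existsUnique_isStationary`). -/
def stationary (K : Matrix X X ℝ) : X → ℝ := Classical.epsilon (IsStationary K)

theorem stationary_spec [Nonempty X] {K : Matrix X X ℝ} (hK : K ∈ Matrix.rowStochastic ℝ X) :
    IsStationary K (stationary K) :=
  Classical.epsilon_spec (exists_isStationary hK)

/-- The continuous-time semigroup `P_t(x,y) = e^{-t} ∑ₙ Kⁿ(x,y) tⁿ / n!`. -/
def heatKernel (K : Matrix X X ℝ) (t : ℝ) (x y : X) : ℝ :=
  Real.exp (-t) * ∑' n : ℕ, (K ^ n) x y * t ^ n / (n.factorial : ℝ)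

/-- Total variation distance between two probability vectors. -/
def tvDist (μ π : X → ℝ) : ℝ := (1 / 2) * ∑ x, |μ x - π x|

/-- Worst-case total variation distance to equilibrium at time `t`. -/
def worstTV (K : Matrix X X ℝ) (t : ℝ) : ℝ :=
  ⨆ o : X, tvDist (heatKernel K t o) (stationary K)

/-- The mixing time `t_mix(ε)`. -/
def mixingTime (K : Matrix X X ℝ) (ε : ℝ) : ℝ := sInf {t : ℝ | 0 ≤ t ∧ worstTV K t ≤ ε}

/-- Relative entropy. -/
def relEntropy (μ π : X → ℝ) : ℝ := ∑ x, μ x * Real.log (μ x / π x)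

/-- Varentropy: the variance of `log (μ / π)` under `μ`. -/
def varentropy (μ π : X → ℝ) : ℝ :=
  ∑ x, μ x * (Real.log (μ x / π x) - relEntropy μ π) ^ 2

/-- Worst-case varentropy at time `t`. -/
def worstVarentropy (K : Matrix X X ℝ) (t : ℝ) : ℝ :=
  ⨆ o : X, varentropy (heatKernel K t o) (stationary K)

/-- The variance of `f` under the probability vector `π`. -/
def variance (π f : X → ℝ) : ℝ := ∑ x, π x * (f x - ∑ y, π y * f y) ^ 2

/-- The Dirichlet form `E(f,f) = ½ ∑ π(x) K(x,y) (f(x) - f(y))²`, which is `⟨f, (I - K) f⟩_π`. -/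
def dirichletForm (K : Matrix X X ℝ) (f : X → ℝ) : ℝ :=
  (1 / 2) * ∑ x, ∑ y, stationary K x * K x y * (f x - f y) ^ 2

/-- The Poincaré constant: the largest `γ` with `γ Var_π(f) ≤ E(f,f)` for every `f`, that is,
the infimum of `E(f,f) / Var_π(f)` over the `f` with nonzero variance. (Such `f` exist as soon as
there are at least two states.) -/
def poincareConst (K : Matrix X X ℝ) : ℝ :=
  sInf {r : ℝ | ∃ f : X → ℝ, variance (stationary K) f ≠ 0 ∧
    r = dirichletForm K f / variance (stationary K) f}

/-- The smallest nonzero entry of `K`. -/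
def minEntry (K : Matrix X X ℝ) : ℝ := sInf {r : ℝ | ∃ x y : X, K x y ≠ 0 ∧ r = K x y}

/-- The support of `K` is symmetric. -/
def SymmetricSupport (K : Matrix X X ℝ) : Prop := ∀ x y : X, 0 < K x y → 0 < K y x

end MarkovCutoff

namespace MarkovCutoff

variable {X : ℕ → Type*} [∀ n, Fintype (X n)] [∀ n, DecidableEq (X n)]

/-- The cutoff phenomenon for a sequence of chains. -/
def HasCutoff (K : ∀ n, Matrix (X n) (X n) ℝ) : Prop :=
  ∀ ε ∈ Set.Ioo (0 : ℝ) 1, ∀ ε' ∈ Set.Ioo (0 : ℝ) 1,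
    Tendsto (fun n => mixingTime (K n) ε' / mixingTime (K n) ε) atTop (𝓝 1)

/-- The varentropy criterion: for each fixed `ε ∈ (0,1)`,
`γ(K_n) · t_mix(ε) ≫ 1 + √(V_KL(t_mix(ε)))`, the ratio of the two sides tending to `+∞`. -/
def VarentropyCriterion (K : ∀ n, Matrix (X n) (X n) ℝ) : Prop :=
  ∀ ε ∈ Set.Ioo (0 : ℝ) 1,
    Tendsto (fun n => poincareConst (K n) * mixingTime (K n) ε /
      (1 + Real.sqrt (worstVarentropy (K n) (mixingTime (K n) ε)))) atTop atTop

end MarkovCutoff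

end

/-! Criterion implies cutoff. Let t be the mixing time at level `1 - κ`, and V the worst varentropy
at t. By Chebyshev, the log-density of `P_t(o,·)` lies within O(1 + √V) of its mean, the relative
entropy. This entropy is itself O(1 + √V): otherwise nearly all the mass would sit on a set of small
π-mass, against total variation at most `1 - κ` (`relEntropy_le_of_tvDist_le`). So, up to mass κ/2,
the density is at most exp(O(1 + √V)), and `L²` decay at rate γ brings the distance below κ after a
further time O((1 + √V)/γ) (`mixingTime_le_mixingTime_add`). The criterion makes this window
negligible.

Cutoff implies criterion. Mixing times tend to infinity, because no chain converges faster than at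
rate 2. Sparsity and symmetric support bound the growth of stationary mass when a set is enlarged by
one step. In time s the chain rarely makes more than 3s steps, so a law concentrated on a very
π-small set stays far from equilibrium (`sum_sub_le_tvDist_vecMul_heatMatrix`). Under cutoff the
chain is almost mixed at time (1 + ρ)t, so at time t the log-density rarely exceeds a small multiple
of t. It never exceeds a constant multiple of t, since -log π = O(t). Hence V = o(t²), and expansion
gives the criterion. -/

namespace MarkovCutoff

variable {X : Type*} [Fintype X] [DecidableEq X]

/-! ### The heat semigroup as a matrix exponential. -/

open scoped Matrix.Norms.Operator in
/-- Power series expansion, entry by entry, of the exponential of a matrix. -/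
theorem hasSum_exp_apply (A : Matrix X X ℝ) (x y : X) :
    HasSum (fun n : ℕ => (n.factorial : ℝ)⁻¹ * (A ^ n) x y) (NormedSpace.exp A x y) := by
  have h := NormedSpace.exp_series_hasSum_exp' (𝕂 := ℝ) A
  let e : Matrix X X ℝ →ₗ[ℝ] ℝ :=
    { toFun := fun M => M x y
      map_add' := fun _ _ => rfl
      map_smul' := fun _ _ => rfl }
  exact h.map e e.continuous_of_finiteDimensional

open scoped Matrix.Norms.Operator in
theorem hasDerivAt_exp_smul_apply (A : Matrix X X ℝ) (t : ℝ) (x y : X) :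
    HasDerivAt (fun s : ℝ => NormedSpace.exp (s • A) x y) ((NormedSpace.exp (t • A) * A) x y) t := by
  have h := hasDerivAt_exp_smul_const (𝕂 := ℝ) A t
  let e : Matrix X X ℝ →ₗ[ℝ] ℝ :=
    { toFun := fun M => M x y
      map_add' := fun _ _ => rfl
      map_smul' := fun _ _ => rfl }
  exact (e.toContinuousLinearMap.hasFDerivAt.comp_hasDerivAt t h)

/-- The heat kernel as a matrix. -/
noncomputable def heatMatrix (K : Matrix X X ℝ) (t : ℝ) : Matrix X X ℝ := Matrix.of (heatKernel K t)

theorem heatMatrix_apply (K : Matrix X X ℝ) (t : ℝ) (x y : X) :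
    heatMatrix K t x y = heatKernel K t x y := rfl

theorem hasSum_heatKernel (K : Matrix X X ℝ) (t : ℝ) (x y : X) :
    HasSum (fun n : ℕ => Real.exp (-t) * (t ^ n / n.factorial) * (K ^ n) x y)
      (heatKernel K t x y) := by
  have h := (hasSum_exp_apply (t • K) x y).summable
  have h' : Summable fun n : ℕ => (K ^ n) x y * t ^ n / (n.factorial : ℝ) := by
    refine h.congr fun n => ?_
    rw [smul_pow, Matrix.smul_apply, smul_eq_mul]
    ring
  have := h'.hasSum.mul_left (Real.exp (-t))
  exact this.congr_fun fun n => by ring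

/-- The identity commutes with `K`, so the scalar factor e^{-t} splits off. The formula holds for
negative `t` too, which later allows the flow to be reversed. -/
theorem heatMatrix_eq_exp (K : Matrix X X ℝ) (t : ℝ) :
    heatMatrix K t = NormedSpace.exp (t • (K - 1)) := by
  have h1 : t • (K - 1) = t • K + (-t) • (1 : Matrix X X ℝ) := by
    rw [smul_sub, neg_smul, sub_eq_add_neg]
  have hc : Commute (t • K) ((-t) • (1 : Matrix X X ℝ)) :=
    ((Commute.one_right K).smul_left t).smul_right (-t)
  have h2 : (-t) • (1 : Matrix X X ℝ) = Matrix.diagonal fun _ => -t := by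
    rw [Matrix.smul_one_eq_diagonal]
  ext x y
  rw [h1, Matrix.exp_add_of_commute _ _ hc, h2, Matrix.exp_diagonal, Matrix.mul_diagonal,
    heatMatrix_apply]
  have h3 := (hasSum_exp_apply (t • K) x y).mul_left (Real.exp (-t))
  rw [mul_comm, Pi.coe_exp, ← Real.exp_eq_exp_ℝ]
  refine (hasSum_heatKernel K t x y).unique (h3.congr_fun ?_)
  intro n
  rw [smul_pow, Matrix.smul_apply, smul_eq_mul]
  ring

theorem heatMatrix_zero (K : Matrix X X ℝ) : heatMatrix K 0 = 1 := by
  rw [heatMatrix_eq_exp, zero_smul, NormedSpace.exp_zero]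

theorem heatMatrix_add (K : Matrix X X ℝ) (s t : ℝ) :
    heatMatrix K (s + t) = heatMatrix K s * heatMatrix K t := by
  simp only [heatMatrix_eq_exp, add_smul]
  exact Matrix.exp_add_of_commute _ _ (((Commute.refl _).smul_left s).smul_right t)

theorem hasDerivAt_heatMatrix (K : Matrix X X ℝ) (t : ℝ) (x y : X) :
    HasDerivAt (fun s => heatMatrix K s x y) ((heatMatrix K t * (K - 1)) x y) t := by
  simpa only [heatMatrix_eq_exp] using hasDerivAt_exp_smul_apply (K - 1) t x y

/-- The function `P_t g` as a Poisson mixture of the functions `Kⁿ g`. -/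
theorem hasSum_heatMatrix_mulVec (K : Matrix X X ℝ) (t : ℝ) (g : X → ℝ) (x : X) :
    HasSum (fun n : ℕ => Real.exp (-t) * (t ^ n / n.factorial) * ((K ^ n).mulVec g) x)
      ((heatMatrix K t).mulVec g x) := by
  have h := hasSum_sum (s := Finset.univ) fun y _ => (hasSum_heatKernel K t x y).mul_right (g y)
  refine h.congr_fun fun n => ?_
  simp only [Matrix.mulVec, dotProduct, Finset.mul_sum, mul_assoc]

theorem hasSum_poisson (t : ℝ) :
    HasSum (fun n : ℕ => Real.exp (-t) * (t ^ n / n.factorial)) 1 := by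
  have h := (NormedSpace.expSeries_div_hasSum_exp t).mul_left (Real.exp (-t))
  rwa [← Real.exp_eq_exp_ℝ, ← Real.exp_add, neg_add_cancel, Real.exp_zero] at h

theorem heatMatrix_mulVec_one {K : Matrix X X ℝ} (hK : K ∈ Matrix.rowStochastic ℝ X) (t : ℝ) :
    (heatMatrix K t).mulVec 1 = 1 := by
  funext x
  refine (hasSum_heatMatrix_mulVec K t 1 x).unique ((hasSum_poisson t).congr_fun fun n => ?_)
  rw [(pow_mem hK n).2, Pi.one_apply, mul_one]

theorem heatMatrix_mem_rowStochastic {K : Matrix X X ℝ} (hK : K ∈ Matrix.rowStochastic ℝ X)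
    {t : ℝ} (ht : 0 ≤ t) : heatMatrix K t ∈ Matrix.rowStochastic ℝ X := by
  refine ⟨fun x y => ?_, heatMatrix_mulVec_one hK t⟩
  refine (hasSum_heatKernel K t x y).nonneg fun n => ?_
  have := (pow_mem hK n).1 x y
  positivity

theorem vecMul_pow_of_isStationary {K : Matrix X X ℝ} {π : X → ℝ} (hπ : IsStationary K π) (n : ℕ) :
    Matrix.vecMul π (K ^ n) = π := by
  induction n with
  | zero => simp
  | succ n ih => rw [pow_succ, ← Matrix.vecMul_vecMul, ih, hπ.2]

theorem vecMul_heatMatrix_of_isStationary {K : Matrix X X ℝ} {π : X → ℝ}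
    (hπ : IsStationary K π) (t : ℝ) : Matrix.vecMul π (heatMatrix K t) = π := by
  funext y
  have h := hasSum_sum (s := Finset.univ) fun x _ => (hasSum_heatKernel K t x y).mul_left (π x)
  refine h.unique ?_
  have h2 := (hasSum_poisson t).mul_right (π y)
  rw [one_mul] at h2
  refine h2.congr_fun fun n => ?_
  conv_rhs => rw [← congrFun (vecMul_pow_of_isStationary hπ n) y]
  simp only [Matrix.vecMul, dotProduct, Finset.mul_sum]
  exact Finset.sum_congr rfl fun x _ => by ring

/-- The heat flow run backwards for a time `t` expands the sup norm by at most `e^{2t}`. -/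
theorem abs_heatMatrix_neg_mulVec_le {K : Matrix X X ℝ} (hK : K ∈ Matrix.rowStochastic ℝ X)
    {t : ℝ} (ht : 0 ≤ t) {g : X → ℝ} {M : ℝ} (hg : ∀ y, |g y| ≤ M) (x : X) :
    |(heatMatrix K (-t)).mulVec g x| ≤ Real.exp (2 * t) * M := by
  have h1 := hasSum_heatMatrix_mulVec K (-t) g x
  -- One factor e^t is the prefactor at time `-t`; the other is the sum of the series taken in
  -- absolute value.
  have h2 : HasSum (fun n : ℕ => Real.exp t * (t ^ n / n.factorial) * M) (Real.exp (2 * t) * M) := by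
    have := ((hasSum_poisson t).mul_left (Real.exp (2 * t))).mul_right M
    rw [mul_one] at this
    refine this.congr_fun fun n => ?_
    rw [← mul_assoc (Real.exp _), ← Real.exp_add]
    ring_nf
  have hb : ∀ n : ℕ, ‖Real.exp (- -t) * ((-t) ^ n / n.factorial) * ((K ^ n).mulVec g) x‖ ≤
      Real.exp t * (t ^ n / n.factorial) * M := by
    intro n
    rw [neg_neg, norm_mul, norm_mul, norm_div, norm_pow, Real.norm_eq_abs, Real.norm_eq_abs,
      abs_neg, abs_of_nonneg ht, Real.abs_exp, Real.norm_natCast]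
    refine mul_le_mul_of_nonneg_left ?_ (by positivity)
    calc ‖(K ^ n).mulVec g x‖ ≤ ∑ y, |(K ^ n) x y * g y| := Finset.abs_sum_le_sum_abs _ _
      _ ≤ ∑ y, (K ^ n) x y * M := by
          refine Finset.sum_le_sum fun y _ => ?_
          rw [abs_mul, abs_of_nonneg ((pow_mem hK n).1 x y)]
          exact mul_le_mul_of_nonneg_left (hg y) ((pow_mem hK n).1 x y)
      _ = M := by rw [← Finset.sum_mul, Matrix.sum_row_of_mem_rowStochastic (pow_mem hK n), one_mul]
  rw [← h1.tsum_eq, ← Real.norm_eq_abs]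
  exact tsum_of_norm_bounded h2 hb

/-! ### The Poincaré inequality and `L²` decay, without reversibility. -/

section Dirichlet

variable {K : Matrix X X ℝ}

theorem stationary_pos [Nonempty X] (hK : K ∈ Matrix.rowStochastic ℝ X) (hirr : K.IsIrreducible)
    (x : X) : 0 < stationary K x := by
  have hπ := stationary_spec hK
  have hex : ∃ y, stationary K y ≠ 0 := by
    by_contra! h
    have := hπ.1.2
    simp [h] at this
  obtain ⟨y, hy⟩ := hex
  obtain ⟨k, -, hk⟩ := (Matrix.isIrreducible_iff_exists_pow_pos hK.1).1 hirr y x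
  rw [← congrFun (vecMul_pow_of_isStationary hπ k) x]
  exact Finset.sum_pos' (fun z _ => mul_nonneg (hπ.1.1 z) ((pow_mem hK k).1 z x))
    ⟨y, Finset.mem_univ y, mul_pos (lt_of_le_of_ne (hπ.1.1 y) hy.symm) hk⟩

theorem dirichletForm_nonneg [Nonempty X] (hK : K ∈ Matrix.rowStochastic ℝ X) (f : X → ℝ) :
    0 ≤ dirichletForm K f := by
  refine mul_nonneg (by norm_num) (Finset.sum_nonneg fun x _ => Finset.sum_nonneg fun y _ => ?_)
  exact mul_nonneg (mul_nonneg ((stationary_spec hK).1.1 x) (hK.1 x y)) (sq_nonneg _)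

theorem variance_nonneg {Y : Type*} [Fintype Y] {π : Y → ℝ} (hπ : π ∈ stdSimplex ℝ Y) (f : Y → ℝ) :
    0 ≤ variance π f :=
  Finset.sum_nonneg fun x _ => mul_nonneg (hπ.1 x) (sq_nonneg _)

theorem poincareConst_nonneg [Nonempty X] (hK : K ∈ Matrix.rowStochastic ℝ X) :
    0 ≤ poincareConst K := by
  refine Real.sInf_nonneg ?_
  rintro r ⟨f, -, rfl⟩
  exact div_nonneg (dirichletForm_nonneg hK f) (variance_nonneg (stationary_spec hK).1 f)

/-- The Poincaré inequality. -/
theorem poincareConst_mul_variance_le [Nonempty X] (hK : K ∈ Matrix.rowStochastic ℝ X)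
    (f : X → ℝ) : poincareConst K * variance (stationary K) f ≤ dirichletForm K f := by
  have hv := variance_nonneg (stationary_spec hK).1 f
  rcases hv.eq_or_lt with h | h
  · rw [← h, mul_zero]
    exact dirichletForm_nonneg hK f
  · rw [← le_div_iff₀ h]
    refine csInf_le ⟨0, ?_⟩ ⟨f, h.ne', rfl⟩
    rintro r ⟨g, -, rfl⟩
    exact div_nonneg (dirichletForm_nonneg hK g) (variance_nonneg (stationary_spec hK).1 g)

/-- The Dirichlet form as a quadratic form `⟨f, (I - K) f⟩_π`. -/
theorem dirichletForm_eq [Nonempty X] (hK : K ∈ Matrix.rowStochastic ℝ X) (f : X → ℝ) :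
    dirichletForm K f = ∑ x, stationary K x * f x ^ 2 -
      ∑ y, (∑ x, stationary K x * f x * K x y) * f y := by
  have hπ := stationary_spec hK
  have h1 : ∑ x, ∑ y, stationary K x * K x y * f x ^ 2 = ∑ x, stationary K x * f x ^ 2 := by
    refine Finset.sum_congr rfl fun x _ => ?_
    rw [← Finset.sum_mul, ← Finset.mul_sum, Matrix.sum_row_of_mem_rowStochastic hK, mul_one]
  have h2 : ∑ x, ∑ y, stationary K x * K x y * f y ^ 2 = ∑ x, stationary K x * f x ^ 2 := by
    rw [Finset.sum_comm]
    refine Finset.sum_congr rfl fun y _ => ?_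
    rw [← Finset.sum_mul]
    congr 1
    exact congrFun hπ.2 y
  have h3 : ∑ y, (∑ x, stationary K x * f x * K x y) * f y =
      ∑ x, ∑ y, stationary K x * K x y * (f x * f y) := by
    rw [Finset.sum_comm]
    refine Finset.sum_congr rfl fun y _ => ?_
    rw [Finset.sum_mul]
    exact Finset.sum_congr rfl fun x _ => by ring
  have h4 : ∑ x, ∑ y, stationary K x * K x y * (f x - f y) ^ 2 =
      ∑ x, ∑ y, stationary K x * K x y * f x ^ 2 + ∑ x, ∑ y, stationary K x * K x y * f y ^ 2 -
        2 * ∑ x, ∑ y, stationary K x * K x y * (f x * f y) := by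
    simp only [Finset.mul_sum, ← Finset.sum_add_distrib, ← Finset.sum_sub_distrib]
    exact Finset.sum_congr rfl fun x _ => Finset.sum_congr rfl fun y _ => by ring
  rw [dirichletForm, h4, h1, h2, h3]
  ring

theorem sum_vecMul_heatMatrix (hK : K ∈ Matrix.rowStochastic ℝ X) (ν : X → ℝ) (t : ℝ) :
    ∑ y, Matrix.vecMul ν (heatMatrix K t) y = ∑ x, ν x := by
  have h := Matrix.dotProduct_mulVec ν (heatMatrix K t) 1
  rw [heatMatrix_mulVec_one hK, dotProduct_one, dotProduct_one] at h
  exact h.symm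

theorem hasDerivAt_vecMul_heatMatrix (K : Matrix X X ℝ) (ν : X → ℝ) (t : ℝ) (y : X) :
    HasDerivAt (fun s => Matrix.vecMul ν (heatMatrix K s) y)
      (∑ z, Matrix.vecMul ν (heatMatrix K t) z * K z y - Matrix.vecMul ν (heatMatrix K t) y) t := by
  have h : HasDerivAt (fun s => ∑ x, ν x * heatMatrix K s x y)
      (∑ x, ν x * (heatMatrix K t * (K - 1)) x y) t :=
    HasDerivAt.fun_sum fun x _ => (hasDerivAt_heatMatrix K t x y).const_mul (ν x)
  refine HasDerivAt.congr_deriv h ?_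
  symm
  change (Matrix.vecMul (Matrix.vecMul ν (heatMatrix K t)) K - Matrix.vecMul ν (heatMatrix K t)) y
    = Matrix.vecMul ν (heatMatrix K t * (K - 1)) y
  rw [Matrix.mul_sub, Matrix.mul_one, Matrix.vecMul_sub, Matrix.vecMul_vecMul]

/-- Exponential decay in `L²(π)`, at the rate given by the Poincaré constant, of the density of a
signed measure of mass zero. -/
theorem sum_sq_div_vecMul_heatMatrix_le [Nonempty X] (hK : K ∈ Matrix.rowStochastic ℝ X)
    (hirr : K.IsIrreducible) {ν : X → ℝ} (hν : ∑ x, ν x = 0) {t : ℝ} (ht : 0 ≤ t) :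
    ∑ y, Matrix.vecMul ν (heatMatrix K t) y ^ 2 / stationary K y ≤
      Real.exp (-(2 * poincareConst K * t)) * ∑ y, ν y ^ 2 / stationary K y := by
  have hπ := stationary_pos hK hirr
  set γ := poincareConst K with hγ
  set v : ℝ → X → ℝ := fun s => Matrix.vecMul ν (heatMatrix K s) with hv
  set D : ℝ → X → ℝ := fun s y => ∑ z, v s z * K z y - v s y with hD
  have hd : ∀ s, HasDerivAt (fun s => Real.exp (2 * γ * s) * ∑ y, v s y ^ 2 / stationary K y)
      (Real.exp (2 * γ * s) * (2 * γ) * ∑ y, v s y ^ 2 / stationary K y +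
        Real.exp (2 * γ * s) * ∑ y, 2 * v s y * D s y / stationary K y) s := by
    intro s
    have h1 : HasDerivAt (fun s : ℝ => Real.exp (2 * γ * s)) (Real.exp (2 * γ * s) * (2 * γ)) s := by
      simpa using ((hasDerivAt_id s).const_mul (2 * γ)).exp
    refine h1.mul (HasDerivAt.fun_sum fun y _ => ?_)
    have h2 := ((hasDerivAt_vecMul_heatMatrix K ν s y).fun_pow 2).div_const (stationary K y)
    simpa using h2
  have hanti := antitone_of_hasDerivAt_nonpos hd fun s => by
    set f : X → ℝ := fun y => v s y / stationary K y with hf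
    have hπf : ∀ x, stationary K x * f x = v s x := fun x => mul_div_cancel₀ _ (hπ x).ne'
    have hmean : ∑ y, stationary K y * f y = 0 := by
      simp only [hπf, hv, sum_vecMul_heatMatrix hK, hν]
    have hvar : variance (stationary K) f = ∑ y, v s y ^ 2 / stationary K y := by
      rw [variance, hmean]
      refine Finset.sum_congr rfl fun y _ => ?_
      have := (hπ y).ne'
      simp only [hf]
      field_simp
      ring
    -- The quadratic form of `K` sees only its symmetric part in `L²(π)`, so this holds for
    -- non-reversible chains.
    have hform : ∑ y, 2 * v s y * D s y / stationary K y = -2 * dirichletForm K f := by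
      rw [dirichletForm_eq hK, ← Finset.sum_sub_distrib, Finset.mul_sum]
      refine Finset.sum_congr rfl fun y _ => ?_
      have := (hπ y).ne'
      simp only [hπf]
      simp only [hD, hf]
      field_simp
      ring
    have hp := poincareConst_mul_variance_le hK f
    rw [hvar] at hp
    rw [hform]
    have he := Real.exp_pos (2 * γ * s)
    change _ ≤ (0 : ℝ)
    nlinarith
  have h0 := hanti ht
  simp only [hv, mul_zero, Real.exp_zero, one_mul, heatMatrix_zero, Matrix.vecMul_one] at h0
  rw [Real.exp_neg, ← div_eq_inv_mul, le_div_iff₀ (Real.exp_pos _), mul_comm]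
  exact h0

theorem sum_abs_vecMul_heatMatrix_le (hK : K ∈ Matrix.rowStochastic ℝ X) (ν : X → ℝ) {t : ℝ}
    (ht : 0 ≤ t) : ∑ y, |Matrix.vecMul ν (heatMatrix K t) y| ≤ ∑ x, |ν x| := by
  have hP := heatMatrix_mem_rowStochastic hK ht
  calc ∑ y, |Matrix.vecMul ν (heatMatrix K t) y|
      ≤ ∑ y, Matrix.vecMul (fun x => |ν x|) (heatMatrix K t) y := by
        refine Finset.sum_le_sum fun y _ => (Finset.abs_sum_le_sum_abs _ _).trans_eq ?_
        refine Finset.sum_congr rfl fun x _ => ?_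
        rw [abs_mul, abs_of_nonneg (hP.1 x y)]
    _ = ∑ x, |ν x| := sum_vecMul_heatMatrix hK _ t

/-- Cauchy–Schwarz against the probability vector π passes from `L²` to `L¹`. -/
theorem sum_abs_vecMul_heatMatrix_le_exp_mul_sqrt [Nonempty X]
    (hK : K ∈ Matrix.rowStochastic ℝ X) (hirr : K.IsIrreducible) {ν : X → ℝ} (hν : ∑ x, ν x = 0)
    {t : ℝ} (ht : 0 ≤ t) : ∑ y, |Matrix.vecMul ν (heatMatrix K t) y| ≤
      Real.exp (-(poincareConst K * t)) * √(∑ y, ν y ^ 2 / stationary K y) := by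
  have h1 := Finset.sq_sum_div_le_sum_sq_div Finset.univ
    (fun y => |Matrix.vecMul ν (heatMatrix K t) y|) fun y _ => stationary_pos hK hirr y
  rw [(stationary_spec hK).1.2, div_one] at h1
  simp only [sq_abs] at h1
  have h2 := h1.trans (sum_sq_div_vecMul_heatMatrix_le hK hirr hν ht)
  have h3 : Real.exp (-(2 * poincareConst K * t)) = Real.exp (-(poincareConst K * t)) ^ 2 := by
    rw [← Real.exp_nat_mul]
    congr 1
    push_cast
    ring
  have hN : 0 ≤ ∑ y, ν y ^ 2 / stationary K y :=
    Finset.sum_nonneg fun y _ => div_nonneg (sq_nonneg _) (stationary_pos hK hirr y).le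
  refine le_of_sq_le_sq ?_ (by positivity)
  rwa [mul_pow, Real.sq_sqrt hN, ← h3]

end Dirichlet

/-! ### Total variation and mixing times. -/

section TotalVariation

/-- The difference has total mass zero, so its excess on `S` equals its deficit off `S`; this
accounts for the factor 1/2. -/
theorem sum_sub_sum_le_tvDist {Y : Type*} [Fintype Y] {μ π : Y → ℝ}
    (hμ : ∑ x, μ x = 1) (hπ : ∑ x, π x = 1) (S : Finset Y) :
    ∑ x ∈ S, μ x - ∑ x ∈ S, π x ≤ tvDist μ π := by
  classical
  have h1 : ∑ x ∈ S, (μ x - π x) ≤ ∑ x ∈ S, |μ x - π x| :=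
    Finset.sum_le_sum fun x _ => le_abs_self _
  have h2 : ∑ x ∈ Sᶜ, -(μ x - π x) ≤ ∑ x ∈ Sᶜ, |μ x - π x| :=
    Finset.sum_le_sum fun x _ => neg_le_abs _
  have h3 := Finset.sum_add_sum_compl S fun x => |μ x - π x|
  have h4 := Finset.sum_add_sum_compl S fun x => μ x - π x
  rw [Finset.sum_neg_distrib] at h2
  have h5 : ∑ x, (μ x - π x) = 0 := by rw [Finset.sum_sub_distrib, hμ, hπ, sub_self]
  rw [← Finset.sum_sub_distrib, tvDist]
  linarith

variable {K : Matrix X X ℝ}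

theorem vecMul_single_heatMatrix (K : Matrix X X ℝ) (t : ℝ) (o : X) :
    Matrix.vecMul (Pi.single o 1) (heatMatrix K t) = heatKernel K t o := by
  rw [Matrix.single_one_vecMul]
  rfl

theorem vecMul_heatKernel_heatMatrix (K : Matrix X X ℝ) (s t : ℝ) (o : X) :
    Matrix.vecMul (heatKernel K s o) (heatMatrix K t) = heatKernel K (s + t) o := by
  rw [← vecMul_single_heatMatrix, Matrix.vecMul_vecMul, ← heatMatrix_add, vecMul_single_heatMatrix]

theorem heatKernel_mem_stdSimplex (hK : K ∈ Matrix.rowStochastic ℝ X) {t : ℝ} (ht : 0 ≤ t) (o : X) :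
    heatKernel K t o ∈ stdSimplex ℝ X :=
  ⟨(heatMatrix_mem_rowStochastic hK ht).1 o,
    Matrix.sum_row_of_mem_rowStochastic (heatMatrix_mem_rowStochastic hK ht) o⟩

theorem tvDist_heatKernel_le_worstTV (K : Matrix X X ℝ) (t : ℝ) (o : X) :
    tvDist (heatKernel K t o) (stationary K) ≤ worstTV K t :=
  le_ciSup (f := fun o => tvDist (heatKernel K t o) (stationary K)) (Set.finite_range _).bddAbove o

theorem tvDist_vecMul_heatMatrix_le [Nonempty X] (hK : K ∈ Matrix.rowStochastic ℝ X) (μ : X → ℝ)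
    {t : ℝ} (ht : 0 ≤ t) :
    tvDist (Matrix.vecMul μ (heatMatrix K t)) (stationary K) ≤ tvDist μ (stationary K) := by
  have h := sum_abs_vecMul_heatMatrix_le hK (μ - stationary K) ht
  rw [Matrix.sub_vecMul, vecMul_heatMatrix_of_isStationary (stationary_spec hK)] at h
  exact mul_le_mul_of_nonneg_left h (by norm_num)

theorem worstTV_anti [Nonempty X] (hK : K ∈ Matrix.rowStochastic ℝ X) {s t : ℝ} (hst : s ≤ t) :
    worstTV K t ≤ worstTV K s := by
  refine ciSup_le fun o => ?_
  have h := tvDist_vecMul_heatMatrix_le hK (heatKernel K s o) (sub_nonneg.2 hst)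
  rw [vecMul_heatKernel_heatMatrix, add_sub_cancel] at h
  exact h.trans (tvDist_heatKernel_le_worstTV K s o)

theorem continuous_tvDist_heatKernel (K : Matrix X X ℝ) (o : X) :
    Continuous fun t => tvDist (heatKernel K t o) (stationary K) := by
  have h : ∀ x, Continuous fun t => heatKernel K t o x := fun x =>
    continuous_iff_continuousAt.2 fun t => (hasDerivAt_heatMatrix K t o x).continuousAt
  unfold tvDist
  fun_prop

/-- Starting from `o`, the chain converges to equilibrium. -/
theorem tendsto_tvDist_heatKernel [Nonempty X] (hK : K ∈ Matrix.rowStochastic ℝ X)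
    (hirr : K.IsIrreducible) (hγ : 0 < poincareConst K) (o : X) :
    Tendsto (fun t => tvDist (heatKernel K t o) (stationary K)) atTop (𝓝 0) := by
  set ν : X → ℝ := Pi.single o 1 - stationary K with hν
  have hsum : ∑ x, ν x = 0 := by
    simp [hν, Finset.sum_sub_distrib, (stationary_spec hK).1.2]
  have hlim : Tendsto (fun t : ℝ => 1 / 2 * (Real.exp (-(poincareConst K * t)) *
      √(∑ y, ν y ^ 2 / stationary K y))) atTop (𝓝 0) := by
    have h1 : Tendsto (fun t : ℝ => Real.exp (-(poincareConst K * t))) atTop (𝓝 0) :=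
      Real.tendsto_exp_neg_atTop_nhds_zero.comp (tendsto_id.const_mul_atTop hγ)
    simpa only [zero_mul, mul_zero] using (h1.mul_const (√(∑ y, ν y ^ 2 / stationary K y))).const_mul (1 / 2)
  refine squeeze_zero' (Eventually.of_forall fun t => ?_) ?_ hlim
  · exact mul_nonneg (by norm_num) (Finset.sum_nonneg fun x _ => abs_nonneg _)
  · filter_upwards [eventually_ge_atTop 0] with t ht
    have h := sum_abs_vecMul_heatMatrix_le_exp_mul_sqrt hK hirr hsum ht
    rw [hν, Matrix.sub_vecMul, vecMul_heatMatrix_of_isStationary (stationary_spec hK),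
      vecMul_single_heatMatrix, ← hν] at h
    exact mul_le_mul_of_nonneg_left h (by norm_num)

theorem mixingTime_nonneg (K : Matrix X X ℝ) (ε : ℝ) : 0 ≤ mixingTime K ε :=
  Real.sInf_nonneg fun _ h => h.1

theorem mixingTime_le {ε t : ℝ} (ht : 0 ≤ t) (h : worstTV K t ≤ ε) : mixingTime K ε ≤ t :=
  csInf_le ⟨0, fun _ h => h.1⟩ ⟨ht, h⟩

/-- The infimum defining the mixing time is attained: the set of admissible times is closed by
continuity and nonempty by convergence. -/
theorem worstTV_mixingTime_le [Nonempty X] (hK : K ∈ Matrix.rowStochastic ℝ X)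
    (hirr : K.IsIrreducible) (hγ : 0 < poincareConst K) {ε : ℝ} (hε : 0 < ε) :
    worstTV K (mixingTime K ε) ≤ ε := by
  have hset : {t : ℝ | 0 ≤ t ∧ worstTV K t ≤ ε} =
      Set.Ici 0 ∩ ⋂ o : X, {t | tvDist (heatKernel K t o) (stationary K) ≤ ε} := by
    ext t
    simp only [Set.mem_inter_iff, Set.mem_Ici, Set.mem_iInter, Set.mem_ofPred_eq, worstTV]
    rw [ciSup_le_iff (Set.finite_range _).bddAbove]
  have hcl : IsClosed {t : ℝ | 0 ≤ t ∧ worstTV K t ≤ ε} := by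
    rw [hset]
    exact isClosed_Ici.inter (isClosed_iInter fun o =>
      isClosed_le (continuous_tvDist_heatKernel K o) continuous_const)
  have hne : {t : ℝ | 0 ≤ t ∧ worstTV K t ≤ ε}.Nonempty := by
    have h1 : ∀ᶠ t in atTop, ∀ o, tvDist (heatKernel K t o) (stationary K) < ε :=
      eventually_all.2 fun o => (tendsto_tvDist_heatKernel hK hirr hγ o).eventually_lt_const hε
    obtain ⟨t, ht, h0⟩ := (h1.and (eventually_ge_atTop 0)).exists
    exact ⟨t, h0, ciSup_le fun o => (ht o).le⟩
  exact (hcl.csInf_mem hne ⟨0, fun _ h => h.1⟩).2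

theorem mixingTime_anti [Nonempty X] (hK : K ∈ Matrix.rowStochastic ℝ X)
    (hirr : K.IsIrreducible) (hγ : 0 < poincareConst K) {ε ε' : ℝ} (hε : 0 < ε) (h : ε ≤ ε') :
    mixingTime K ε' ≤ mixingTime K ε :=
  mixingTime_le (mixingTime_nonneg K ε) ((worstTV_mixingTime_le hK hirr hγ hε).trans h)

theorem stationary_lt_one [Nontrivial X] (hK : K ∈ Matrix.rowStochastic ℝ X)
    (hirr : K.IsIrreducible) (x : X) : stationary K x < 1 := by
  obtain ⟨y, hy⟩ := exists_ne x
  rw [← (stationary_spec hK).1.2]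
  exact Finset.single_lt_sum hy (Finset.mem_univ x) (Finset.mem_univ y) (stationary_pos hK hirr y)
    fun z _ _ => (stationary_pos hK hirr z).le

/-- A chain with at least two states does not mix faster than at rate `2`. -/
theorem exp_neg_two_mul_le_worstTV [Nontrivial X] (hK : K ∈ Matrix.rowStochastic ℝ X)
    (hirr : K.IsIrreducible) {t : ℝ} (ht : 0 ≤ t) :
    Real.exp (-(2 * t)) ≤ 2 * worstTV K t := by
  obtain ⟨a⟩ := (inferInstance : Nonempty X)
  -- A centred indicator: since its π-mean is zero, `P_t f` depends only on `P_t - π` and is small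
  -- when the chain is mixed.
  set f : X → ℝ := fun x => (Pi.single a 1 : X → ℝ) x - stationary K a with hf
  have hmean : ∑ x, stationary K x * f x = 0 := by
    simp [hf, mul_sub, Finset.sum_sub_distrib, ← Finset.sum_mul, (stationary_spec hK).1.2,
      Pi.single_apply]
  obtain ⟨m, hm⟩ := Finite.exists_max fun x => |f x|
  have hpos : 0 < |f m| := by
    refine lt_of_lt_of_le ?_ (hm a)
    have := stationary_lt_one hK hirr a
    simp only [hf, Pi.single_eq_same]
    exact abs_pos.2 (by linarith)
  have h1 : ∀ x, |(heatMatrix K t).mulVec f x| ≤ 2 * worstTV K t * |f m| := by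
    intro x
    have h2 : (heatMatrix K t).mulVec f x = ∑ y, (heatKernel K t x y - stationary K y) * f y := by
      simp only [sub_mul, Finset.sum_sub_distrib, hmean, sub_zero]
      rfl
    rw [h2]
    calc |∑ y, (heatKernel K t x y - stationary K y) * f y|
        ≤ ∑ y, |(heatKernel K t x y - stationary K y) * f y| := Finset.abs_sum_le_sum_abs _ _
      _ ≤ ∑ y, |heatKernel K t x y - stationary K y| * |f m| := by
          refine Finset.sum_le_sum fun y _ => ?_
          rw [abs_mul]
          exact mul_le_mul_of_nonneg_left (hm y) (abs_nonneg _)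
      _ = 2 * tvDist (heatKernel K t x) (stationary K) * |f m| := by
          rw [← Finset.sum_mul, tvDist]
          ring
      _ ≤ 2 * worstTV K t * |f m| := by
          have := tvDist_heatKernel_le_worstTV K t x
          gcongr
  -- Reversing the flow recovers `f` from `P_t f` at a cost of at most e^{2t}, so `P_t f` cannot be
  -- too small.
  have h3 := abs_heatMatrix_neg_mulVec_le hK ht h1 m
  rw [Matrix.mulVec_mulVec, ← heatMatrix_add, neg_add_cancel, heatMatrix_zero,
    Matrix.one_mulVec] at h3
  have h4 : 1 ≤ Real.exp (2 * t) * (2 * worstTV K t) := by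
    have : 1 * |f m| ≤ Real.exp (2 * t) * (2 * worstTV K t) * |f m| := by
      rw [one_mul, mul_assoc]
      exact h3
    exact le_of_mul_le_mul_right this hpos
  rw [Real.exp_neg, inv_eq_one_div, div_le_iff₀ (Real.exp_pos _), mul_comm]
  exact h4

theorem log_le_mixingTime [Nontrivial X] (hK : K ∈ Matrix.rowStochastic ℝ X)
    (hirr : K.IsIrreducible) (hγ : 0 < poincareConst K) {ε : ℝ} (hε : 0 < ε) :
    -Real.log (2 * ε) / 2 ≤ mixingTime K ε := by
  have h1 := exp_neg_two_mul_le_worstTV hK hirr (mixingTime_nonneg K ε)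
  have h2 := worstTV_mixingTime_le hK hirr hγ hε
  have h3 : Real.exp (-(2 * mixingTime K ε)) ≤ 2 * ε := by linarith
  have := (Real.le_log_iff_exp_le (by positivity)).2 h3
  linarith

end TotalVariation

/-! ### Concentration of the log-density. -/

section Truncation

variable {Y : Type*} [Fintype Y] {μ π : Y → ℝ}

theorem varentropy_nonneg (hμ : ∀ x, 0 ≤ μ x) : 0 ≤ varentropy μ π :=
  Finset.sum_nonneg fun x _ => mul_nonneg (hμ x) (sq_nonneg _)

/-- Chebyshev's inequality for the information content `log (μ / π)`. -/
theorem sum_filter_deviation_le (hμ : ∀ x, 0 ≤ μ x) {r : ℝ} (hr : 0 < r) :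
    ∑ x with r * (1 + √(varentropy μ π)) ≤ |Real.log (μ x / π x) - relEntropy μ π|, μ x ≤
      1 / r ^ 2 := by
  have hV := varentropy_nonneg (π := π) hμ
  set V := varentropy μ π with hVdef
  -- The added 1 keeps the threshold positive when the varentropy vanishes.
  set w := 1 + √V with hw
  have hw1 : 1 ≤ w := by
    have := Real.sqrt_nonneg V
    linarith
  have hVw : V ≤ w ^ 2 := by
    have h1 := Real.sq_sqrt hV
    have h2 := Real.sqrt_nonneg V
    nlinarith
  have h : (∑ x with r * w ≤ |Real.log (μ x / π x) - relEntropy μ π|, μ x) * (r * w) ^ 2 ≤ V := by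
    rw [Finset.sum_mul, hVdef, varentropy]
    refine (Finset.sum_le_sum fun x hx => ?_).trans (Finset.sum_le_sum_of_subset_of_nonneg
      (Finset.filter_subset _ _) fun x _ _ => mul_nonneg (hμ x) (sq_nonneg _))
    refine mul_le_mul_of_nonneg_left ?_ (hμ x)
    rw [← sq_abs (Real.log _ - _)]
    exact pow_le_pow_left₀ (by positivity) (Finset.mem_filter.1 hx).2 2
  rw [le_div_iff₀ (by positivity)]
  have hw2 : 0 < w ^ 2 := by positivity
  refine le_of_mul_le_mul_right ?_ hw2
  rw [one_mul, mul_assoc, ← mul_pow]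
  exact h.trans hVw

/-- Reversed Pinsker inequality: if `μ` is not almost singular to `π`, then its relative entropy is
controlled by its varentropy. -/
theorem relEntropy_le_of_tvDist_le (hμ : μ ∈ stdSimplex ℝ Y) (hπ : π ∈ stdSimplex ℝ Y)
    (hpos : ∀ x, 0 < π x) {κ r : ℝ} (hκ : 0 < κ) (hκ1 : κ < 1) (hr : 0 < r)
    (hr2 : 1 / r ^ 2 ≤ κ / 2) (htv : tvDist μ π ≤ 1 - κ) :
    relEntropy μ π ≤ r * (1 + √(varentropy μ π)) + Real.log (2 / κ) := by
  by_contra! hcon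
  -- Off the deviation set the density exceeds e^b > 2/κ. That complement has μ-mass at least 1 -
  -- κ/2 and π-mass below κ/2, which forces a distance above 1 - κ.
  set b := relEntropy μ π - r * (1 + √(varentropy μ π)) with hb
  have hlog : 0 < Real.log (2 / κ) := Real.log_pos (by rw [lt_div_iff₀ hκ]; linarith)
  have hb' : Real.log (2 / κ) < b := by linarith
  set S : Finset Y := Finset.univ.filter fun x =>
    r * (1 + √(varentropy μ π)) ≤ |Real.log (μ x / π x) - relEntropy μ π| with hS
  have hcheb : ∑ x ∈ S, μ x ≤ 1 / r ^ 2 := sum_filter_deviation_le hμ.1 hr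
  classical
  have hsplit := Finset.sum_add_sum_compl S μ
  rw [hμ.2] at hsplit
  have hπS : ∑ x ∈ Sᶜ, π x ≤ ∑ x ∈ Sᶜ, μ x * Real.exp (-b) := by
    refine Finset.sum_le_sum fun x hx => ?_
    have hx' : ¬ r * (1 + √(varentropy μ π)) ≤ |Real.log (μ x / π x) - relEntropy μ π| := by
      simpa [hS] using hx
    have hgt : b < Real.log (μ x / π x) := by
      have := neg_abs_le (Real.log (μ x / π x) - relEntropy μ π)
      linarith
    -- A zero density is excluded because `Real.log 0 = 0` while `b` is positive.
    have hμx : 0 < μ x / π x := by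
      refine (div_nonneg (hμ.1 x) (hpos x).le).lt_of_ne fun h0 => ?_
      rw [← h0, Real.log_zero] at hgt
      linarith
    have := (Real.lt_log_iff_exp_lt hμx).1 hgt
    rw [lt_div_iff₀ (hpos x)] at this
    rw [Real.exp_neg, ← div_eq_mul_inv, le_div_iff₀ (Real.exp_pos b)]
    linarith
  have hexp : Real.exp (-b) < κ / 2 := by
    have h2 := (Real.log_lt_iff_lt_exp (by positivity)).1 hb'
    rw [Real.exp_neg, inv_lt_comm₀ (Real.exp_pos b) (by positivity), inv_div]
    exact h2
  have hle1 : ∑ x ∈ Sᶜ, μ x ≤ 1 := by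
    have := Finset.sum_nonneg fun x (_ : x ∈ S) => hμ.1 x
    linarith
  rw [← Finset.sum_mul] at hπS
  have h3 : (∑ x ∈ Sᶜ, μ x) * Real.exp (-b) ≤ 1 * Real.exp (-b) :=
    mul_le_mul_of_nonneg_right hle1 (Real.exp_pos _).le
  have h4 := sum_sub_sum_le_tvDist hμ.2 hπ.2 Sᶜ
  linarith

end Truncation

/-! ### Width of the mixing window. -/

section Mixing

variable {K : Matrix X X ℝ}

/-- Mixing from a distribution `μ`: discard the states where `log (μ / π) > a`, and apply the
`L²` decay to the rest. -/
theorem tvDist_vecMul_heatMatrix_le_truncation [Nonempty X] (hK : K ∈ Matrix.rowStochastic ℝ X)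
    (hirr : K.IsIrreducible) {μ : X → ℝ} (hμ : μ ∈ stdSimplex ℝ X) (a : ℝ) {s : ℝ} (hs : 0 ≤ s) :
    tvDist (Matrix.vecMul μ (heatMatrix K s)) (stationary K) ≤
      ∑ x with a < Real.log (μ x / stationary K x), μ x +
        1 / 2 * Real.exp (a / 2 - poincareConst K * s) := by
  have hπ := stationary_spec hK
  have hpos := stationary_pos hK hirr
  set π := stationary K with hπdef
  set ν : X → ℝ := fun x => if a < Real.log (μ x / π x) then 0 else μ x with hν
  set m : ℝ := ∑ x, ν x with hm
  set tail : ℝ := ∑ x with a < Real.log (μ x / π x), μ x with htail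
  have hνle : ∀ x, ν x ≤ μ x := fun x => by
    simp only [hν]
    split_ifs
    exacts [hμ.1 x, le_rfl]
  have hνnn : ∀ x, 0 ≤ ν x := fun x => by
    simp only [hν]
    split_ifs
    exacts [le_rfl, hμ.1 x]
  have htailm : ∑ x, (μ x - ν x) = tail := by
    rw [htail, Finset.sum_filter]
    refine Finset.sum_congr rfl fun x _ => ?_
    simp only [hν]
    split_ifs <;> simp
  have hm1 : 1 - m = tail := by
    rw [← htailm, Finset.sum_sub_distrib, hμ.2]
  have hm0 : 0 ≤ m := Finset.sum_nonneg fun x _ => hνnn x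
  have htail0 : 0 ≤ tail := by
    rw [← htailm]
    exact Finset.sum_nonneg fun x _ => sub_nonneg.2 (hνle x)
  have hνexp : ∀ x, ν x ≤ Real.exp a * π x := by
    intro x
    simp only [hν]
    split_ifs with h
    · exact mul_nonneg (Real.exp_pos a).le (hpos x).le
    · rcases (hμ.1 x).eq_or_lt with h0 | h0
      · rw [← h0]
        exact mul_nonneg (Real.exp_pos a).le (hpos x).le
      · rw [← div_le_iff₀ (hpos x)]
        exact (Real.log_le_iff_le_exp (div_pos h0 (hpos x))).1 (not_lt.1 h)
  -- The `L²` decay needs mass zero, so the truncated measure is centred; its density is at most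
  -- e^a, which bounds the squared norm by e^a.
  set η : X → ℝ := ν - m • π with hη
  have hηsum : ∑ x, η x = 0 := by
    simp only [hη, Pi.sub_apply, Pi.smul_apply, smul_eq_mul, Finset.sum_sub_distrib,
      ← Finset.mul_sum, hπ.1.2, mul_one]
    exact sub_self m
  have hN : ∑ x, η x ^ 2 / π x ≤ Real.exp a := by
    have h1 : ∀ x, η x ^ 2 / π x = ν x ^ 2 / π x - 2 * m * ν x + m ^ 2 * π x := fun x => by
      have := (hpos x).ne'
      simp only [hη, Pi.sub_apply, Pi.smul_apply, smul_eq_mul]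
      field_simp
      ring
    have h2 : ∑ x, η x ^ 2 / π x = ∑ x, ν x ^ 2 / π x - m ^ 2 := by
      simp only [h1, Finset.sum_add_distrib, Finset.sum_sub_distrib, ← Finset.mul_sum, hπ.1.2]
      rw [← hm]
      ring
    have h3 : ∑ x, ν x ^ 2 / π x ≤ ∑ x, Real.exp a * ν x := by
      refine Finset.sum_le_sum fun x _ => ?_
      rw [div_le_iff₀ (hpos x)]
      nlinarith [hνexp x, hνnn x]
    rw [← Finset.mul_sum, ← hm] at h3
    have h4 : Real.exp a * m ≤ Real.exp a * 1 :=
      mul_le_mul_of_nonneg_left (by linarith) (Real.exp_pos a).le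
    nlinarith [sq_nonneg m]
  have hA := sum_abs_vecMul_heatMatrix_le hK (μ - ν) hs
  have hB := sum_abs_vecMul_heatMatrix_le_exp_mul_sqrt hK hirr hηsum hs
  have hA' : ∑ x, |(μ - ν) x| = tail := by
    rw [← htailm]
    exact Finset.sum_congr rfl fun x _ => abs_of_nonneg (sub_nonneg.2 (hνle x))
  have hB' : Real.exp (-(poincareConst K * s)) * √(∑ x, η x ^ 2 / π x) ≤
      Real.exp (a / 2 - poincareConst K * s) := by
    rw [sub_eq_add_neg, Real.exp_add, mul_comm, Real.exp_half]
    exact mul_le_mul_of_nonneg_right (Real.sqrt_le_sqrt hN) (Real.exp_pos _).le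
  -- The discarded mass enters twice, through μ - ν and through `tail • π`; the 1/2 in total
  -- variation leaves it once.
  have hdec : Matrix.vecMul μ (heatMatrix K s) - π =
      Matrix.vecMul (μ - ν) (heatMatrix K s) + Matrix.vecMul η (heatMatrix K s) - tail • π := by
    rw [hη, Matrix.sub_vecMul, Matrix.sub_vecMul, Matrix.smul_vecMul,
      vecMul_heatMatrix_of_isStationary hπ, ← hm1, sub_smul, one_smul]
    abel
  have hC : ∑ x, |Matrix.vecMul μ (heatMatrix K s) x - π x| ≤
      ∑ x, |Matrix.vecMul (μ - ν) (heatMatrix K s) x| +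
        ∑ x, |Matrix.vecMul η (heatMatrix K s) x| + tail := by
    have h5 : tail = ∑ x, tail * π x := by rw [← Finset.mul_sum, hπ.1.2, mul_one]
    conv_rhs => rw [h5]
    rw [← Finset.sum_add_distrib, ← Finset.sum_add_distrib]
    refine Finset.sum_le_sum fun x _ => ?_
    have h6 := congrFun hdec x
    simp only [Pi.sub_apply, Pi.add_apply, Pi.smul_apply, smul_eq_mul] at h6
    rw [h6]
    refine (abs_sub _ _).trans (add_le_add (abs_add_le _ _) ?_)
    rw [abs_of_nonneg (mul_nonneg htail0 (hpos x).le)]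
  rw [tvDist]
  linarith

theorem varentropy_le_worstVarentropy (K : Matrix X X ℝ) (t : ℝ) (o : X) :
    varentropy (heatKernel K t o) (stationary K) ≤ worstVarentropy K t :=
  le_ciSup (f := fun o => varentropy (heatKernel K t o) (stationary K))
    (Set.finite_range _).bddAbove o

/-- The width of the mixing window is controlled by the varentropy at its beginning. -/
theorem mixingTime_le_mixingTime_add [Nonempty X] (hK : K ∈ Matrix.rowStochastic ℝ X)
    (hirr : K.IsIrreducible) (hγ : 0 < poincareConst K) {κ : ℝ} (hκ : 0 < κ) (hκ1 : κ < 1) :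
    mixingTime K κ ≤ mixingTime K (1 - κ) + (√(2 / κ) + 2 * Real.log (2 / κ)) *
      (1 + √(worstVarentropy K (mixingTime K (1 - κ)))) / poincareConst K := by
  set t := mixingTime K (1 - κ) with ht
  set W := worstVarentropy K t with hW
  set r := √(2 / κ) with hr
  set ℓ := Real.log (2 / κ) with hℓ
  have ht0 : 0 ≤ t := mixingTime_nonneg K _
  have hr0 : 0 < r := Real.sqrt_pos.2 (by positivity)
  have hr2 : 1 / r ^ 2 = κ / 2 := by rw [hr, Real.sq_sqrt (by positivity), one_div_div]
  have hℓ0 : 0 < ℓ := Real.log_pos (by rw [lt_div_iff₀ hκ]; linarith)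
  have hsW := Real.sqrt_nonneg W
  -- Half of the truncation level is at most r(1 + √W) + ℓ/2, so this `s` makes the decay exponent
  -- at most -ℓ, and e^{-ℓ} = κ/2. The value of `r` makes the Chebyshev tail at most κ/2.
  set s := (r + 2 * ℓ) * (1 + √W) / poincareConst K with hs
  have hs0 : 0 ≤ s := by positivity
  refine mixingTime_le (by positivity) (ciSup_le fun o => ?_)
  have hμ := heatKernel_mem_stdSimplex hK ht0 o
  have hπ := (stationary_spec hK).1
  have htv : tvDist (heatKernel K t o) (stationary K) ≤ 1 - κ :=
    (tvDist_heatKernel_le_worstTV K t o).trans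
      (worstTV_mixingTime_le hK hirr hγ (by linarith))
  rw [← vecMul_heatKernel_heatMatrix]
  set μ := heatKernel K t o with hμdef
  have hVW : √(varentropy μ (stationary K)) ≤ √W :=
    Real.sqrt_le_sqrt (varentropy_le_worstVarentropy K t o)
  set v := √(varentropy μ (stationary K)) with hv
  have hH := relEntropy_le_of_tvDist_le hμ hπ (stationary_pos hK hirr) hκ hκ1 hr0 hr2.le htv
  have h1 := tvDist_vecMul_heatMatrix_le_truncation hK hirr hμ
    (relEntropy μ (stationary K) + r * (1 + v)) hs0
  have h2 : ∑ x with relEntropy μ (stationary K) + r * (1 + v) < Real.log (μ x / stationary K x),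
      μ x ≤ κ / 2 := by
    rw [← hr2]
    refine (Finset.sum_le_sum_of_subset_of_nonneg ?_ fun x _ _ => hμ.1 x).trans
      (sum_filter_deviation_le hμ.1 hr0 (π := stationary K))
    refine Finset.monotone_filter_right _ fun x _ hx => ?_
    have := le_abs_self (Real.log (μ x / stationary K x) - relEntropy μ (stationary K))
    rw [← hv]
    linarith
  have hγs : poincareConst K * s = (r + 2 * ℓ) * (1 + √W) := mul_div_cancel₀ _ hγ.ne'
  have h3 : Real.exp ((relEntropy μ (stationary K) + r * (1 + v)) / 2 - poincareConst K * s) ≤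
      κ / 2 := by
    have h4 : κ / 2 = Real.exp (-ℓ) := by
      rw [Real.exp_neg, hℓ, Real.exp_log (by positivity), inv_div]
    rw [h4, Real.exp_le_exp, hγs]
    have h5 : r * (1 + v) ≤ r * (1 + √W) := by gcongr
    nlinarith [mul_nonneg hℓ0.le hsW]
  linarith

end Mixing

/-! ### Sparse chains escape slowly from small sets. -/

section Thickening

theorem sum_biUnion_le_sum_sum {ι Y : Type*} [DecidableEq Y] {f : Y → ℝ} (hf : ∀ y, 0 ≤ f y)
    (s : Finset ι) (t : ι → Finset Y) :
    ∑ y ∈ s.biUnion t, f y ≤ ∑ i ∈ s, ∑ y ∈ t i, f y := by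
  classical
  induction s using Finset.induction_on with
  | empty => simp
  | insert i s hi ih =>
    rw [Finset.biUnion_insert, Finset.sum_insert hi]
    have h1 := Finset.sum_union_inter (s₁ := t i) (s₂ := s.biUnion t) (f := f)
    have h2 : 0 ≤ ∑ y ∈ t i ∩ s.biUnion t, f y := Finset.sum_nonneg fun y _ => hf y
    linarith

variable {K : Matrix X X ℝ}

open Classical in
/-- The set `A` together with all the states that can be reached from `A` in one step. -/
noncomputable def thickening (K : Matrix X X ℝ) (A : Finset X) : Finset X :=
  A ∪ A.biUnion fun x => Finset.univ.filter fun y => 0 < K x y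

theorem subset_thickening (K : Matrix X X ℝ) (A : Finset X) : A ⊆ thickening K A := by
  classical
  exact Finset.subset_union_left

theorem mem_thickening {A : Finset X} {x y : X} (hx : x ∈ A) (hxy : 0 < K x y) :
    y ∈ thickening K A := by
  classical
  exact Finset.mem_union_right _ (Finset.mem_biUnion.2 ⟨x, hx, by simpa using hxy⟩)

/-- For a sparse chain with symmetric support, thickening a set multiplies its stationary mass by
at most a constant. -/
theorem sum_thickening_le [Nonempty X] (hK : K ∈ Matrix.rowStochastic ℝ X)
    (hsymm : SymmetricSupport K) {δ : ℝ} (hδ : 0 < δ) (hKδ : ∀ x y, 0 < K x y → δ ≤ K x y)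
    (A : Finset X) : ∑ x ∈ thickening K A, stationary K x ≤
      (1 + 1 / δ ^ 2) * ∑ x ∈ A, stationary K x := by
  classical
  have hπ := stationary_spec hK
  -- Symmetric support provides the reverse edge, and stationarity gives π(x) ≥ π(y) K(y,x) ≥ δ
  -- π(y).
  have hnb : ∀ x y, 0 < K x y → stationary K y ≤ stationary K x / δ := by
    intro x y hxy
    rw [le_div_iff₀ hδ, ← congrFun hπ.2 x]
    calc stationary K y * δ ≤ stationary K y * K y x :=
          mul_le_mul_of_nonneg_left (hKδ y x (hsymm x y hxy)) (hπ.1.1 y)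
      _ ≤ ∑ z, stationary K z * K z x :=
          Finset.single_le_sum (f := fun z => stationary K z * K z x)
            (fun z _ => mul_nonneg (hπ.1.1 z) (hK.1 z x)) (Finset.mem_univ y)
  -- The second factor 1/δ bounds the number of neighbours: each takes at least δ of a row of sum
  -- one.
  have hpt : ∀ x, ∑ y with 0 < K x y, stationary K y ≤ 1 / δ ^ 2 * stationary K x := by
    intro x
    have hx := hπ.1.1 x
    calc ∑ y with 0 < K x y, stationary K y
        ≤ ∑ y with 0 < K x y, K x y * (1 / δ ^ 2 * stationary K x) := by
          refine Finset.sum_le_sum fun y hy => ?_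
          have hy' := (Finset.mem_filter.1 hy).2
          have h1 := hnb x y hy'
          have h2 : δ * (1 / δ ^ 2 * stationary K x) ≤ K x y * (1 / δ ^ 2 * stationary K x) :=
            mul_le_mul_of_nonneg_right (hKδ x y hy') (by positivity)
          have h3 : δ * (1 / δ ^ 2 * stationary K x) = stationary K x / δ := by
            field_simp
          linarith
      _ ≤ ∑ y, K x y * (1 / δ ^ 2 * stationary K x) :=
          Finset.sum_le_sum_of_subset_of_nonneg (Finset.filter_subset _ _) fun y _ _ =>
            mul_nonneg (hK.1 x y) (by positivity)
      _ = 1 / δ ^ 2 * stationary K x := by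
          rw [← Finset.sum_mul, Matrix.sum_row_of_mem_rowStochastic hK, one_mul]
  have h1 : ∑ x ∈ thickening K A, stationary K x ≤ ∑ x ∈ A, stationary K x +
      ∑ x ∈ A, ∑ y with 0 < K x y, stationary K y := by
    unfold thickening
    have h2 := Finset.sum_union_inter (s₁ := A)
      (s₂ := A.biUnion fun x => Finset.univ.filter fun y => 0 < K x y) (f := stationary K)
    have h3 : 0 ≤ ∑ x ∈ A ∩ A.biUnion fun x => Finset.univ.filter fun y => 0 < K x y,
        stationary K x := Finset.sum_nonneg fun x _ => hπ.1.1 x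
    have h4 := sum_biUnion_le_sum_sum hπ.1.1 A fun x => Finset.univ.filter fun y => 0 < K x y
    linarith
  refine h1.trans ?_
  rw [add_mul, one_mul, Finset.mul_sum]
  gcongr with x
  exact hpt x

theorem sum_iterate_thickening_le [Nonempty X] (hK : K ∈ Matrix.rowStochastic ℝ X)
    (hsymm : SymmetricSupport K) {δ : ℝ} (hδ : 0 < δ) (hKδ : ∀ x y, 0 < K x y → δ ≤ K x y)
    (A : Finset X) (k : ℕ) : ∑ x ∈ (thickening K)^[k] A, stationary K x ≤
      (1 + 1 / δ ^ 2) ^ k * ∑ x ∈ A, stationary K x := by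
  induction k with
  | zero => simp
  | succ k ih =>
    rw [Function.iterate_succ_apply', pow_succ', mul_assoc]
    exact (sum_thickening_le hK hsymm hδ hKδ _).trans
      (mul_le_mul_of_nonneg_left ih (by positivity))

theorem pow_apply_eq_zero_of_notMem (hK : K ∈ Matrix.rowStochastic ℝ X) {A : Finset X} {x y : X}
    (hx : x ∈ A) {j k : ℕ} (hjk : j ≤ k) (hy : y ∉ (thickening K)^[k] A) : (K ^ j) x y = 0 := by
  induction k generalizing j y with
  | zero =>
    obtain rfl : j = 0 := by omega
    have hxy : x ≠ y := fun h => hy (h ▸ hx)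
    simp [hxy]
  | succ k ih =>
    rw [Function.iterate_succ_apply'] at hy
    rcases Nat.lt_or_ge k j with h | h
    · obtain rfl : j = k + 1 := by omega
      rw [pow_succ, Matrix.mul_apply]
      refine Finset.sum_eq_zero fun z _ => ?_
      by_cases hz : z ∈ (thickening K)^[k] A
      · have hzy : K z y = 0 := by
          by_contra h0
          exact hy (mem_thickening hz (lt_of_le_of_ne (hK.1 z y) (Ne.symm h0)))
        rw [hzy, mul_zero]
      · rw [ih le_rfl hz, zero_mul]
    · exact ih h fun hy' => hy (subset_thickening K _ hy')

/-- In time `s`, the chain rarely makes more than `k` steps if `k` is large compared to `s`. -/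
theorem sum_compl_iterate_thickening_le (hK : K ∈ Matrix.rowStochastic ℝ X) {A : Finset X} {x : X}
    (hx : x ∈ A) {s : ℝ} (hs : 0 ≤ s) (k : ℕ) :
    ∑ y ∈ ((thickening K)^[k] A)ᶜ, heatKernel K s x y ≤ Real.exp (2 * s - k) := by
  set B := (thickening K)^[k] A with hB
  have h1 := hasSum_sum (s := Bᶜ) fun y _ => hasSum_heatKernel K s x y
  -- Exponential Markov inequality for the Poisson number of steps: the indicator of n > k is at
  -- most e^{n-k}. The final bound uses e - 1 < 2.
  have h2 : HasSum (fun n : ℕ => Real.exp (-s) * (s ^ n / n.factorial) * Real.exp (n - k))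
      (Real.exp ((Real.exp 1 - 1) * s - k)) := by
    have h3 := (hasSum_poisson (Real.exp 1 * s)).mul_left (Real.exp ((Real.exp 1 - 1) * s - k))
    rw [mul_one] at h3
    refine h3.congr_fun fun n => ?_
    rw [mul_pow, ← Real.exp_nat_mul, mul_one, ← mul_assoc, ← Real.exp_add, mul_div_assoc,
      ← mul_assoc, ← Real.exp_add, mul_right_comm, ← Real.exp_add]
    ring_nf
  have h4 : ∑ y ∈ Bᶜ, heatKernel K s x y ≤ Real.exp ((Real.exp 1 - 1) * s - k) := by
    refine hasSum_le (fun n => ?_) h1 h2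
    rw [← Finset.mul_sum]
    refine mul_le_mul_of_nonneg_left ?_ (by positivity)
    rcases Nat.lt_or_ge k n with h | h
    · have h5 : ∑ y ∈ Bᶜ, (K ^ n) x y ≤ 1 := by
        rw [← Matrix.sum_row_of_mem_rowStochastic (pow_mem hK n) x]
        exact Finset.sum_le_sum_of_subset_of_nonneg (Finset.subset_univ _)
          fun y _ _ => (pow_mem hK n).1 x y
      refine h5.trans (Real.one_le_exp ?_)
      rw [sub_nonneg]
      exact_mod_cast h.le
    · rw [Finset.sum_eq_zero fun y hy =>
        pow_apply_eq_zero_of_notMem hK hx h (Finset.mem_compl.1 hy)]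
      exact (Real.exp_pos _).le
  refine h4.trans (Real.exp_le_exp.2 ?_)
  have := Real.exp_one_lt_d9
  nlinarith

/-- A distribution that gives a large mass to a small set remains far from equilibrium for some
time. -/
theorem sum_sub_le_tvDist_vecMul_heatMatrix [Nonempty X] (hK : K ∈ Matrix.rowStochastic ℝ X)
    (hsymm : SymmetricSupport K) {δ : ℝ} (hδ : 0 < δ) (hKδ : ∀ x y, 0 < K x y → δ ≤ K x y)
    {μ : X → ℝ} (hμ : μ ∈ stdSimplex ℝ X) (A : Finset X) {s : ℝ} (hs : 0 ≤ s) :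
    ∑ x ∈ A, μ x - Real.exp (-s) -
        Real.exp (Real.log (1 + 1 / δ ^ 2) * (3 * s + 1)) * ∑ x ∈ A, stationary K x ≤
      tvDist (Matrix.vecMul μ (heatMatrix K s)) (stationary K) := by
  -- With k ≥ 3s the escape bound e^{2s-k} is at most e^{-s}; rounding up costs the `+ 1` in the
  -- growth exponent.
  set k := ⌈3 * s⌉₊ with hk
  have hk1 : 3 * s ≤ k := Nat.le_ceil _
  have hk2 : (k : ℝ) ≤ 3 * s + 1 := (Nat.ceil_lt_add_one (by positivity)).le
  set B := (thickening K)^[k] A with hB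
  have hP := heatMatrix_mem_rowStochastic hK hs
  have hπ := stationary_spec hK
  have hC1 : 1 ≤ 1 + 1 / δ ^ 2 := by
    have : 0 ≤ 1 / δ ^ 2 := by positivity
    linarith
  have hπB : ∑ x ∈ B, stationary K x ≤
      Real.exp (Real.log (1 + 1 / δ ^ 2) * (3 * s + 1)) * ∑ x ∈ A, stationary K x := by
    refine (sum_iterate_thickening_le hK hsymm hδ hKδ A k).trans
      (mul_le_mul_of_nonneg_right ?_ (Finset.sum_nonneg fun x _ => hπ.1.1 x))
    rw [← Real.rpow_natCast, Real.rpow_def_of_pos (by linarith)]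
    exact Real.exp_le_exp.2 (mul_le_mul_of_nonneg_left hk2 (Real.log_nonneg hC1))
  have hout : ∀ x ∈ A, 1 - Real.exp (-s) ≤ ∑ y ∈ B, heatMatrix K s x y := by
    intro x hx
    have h1 := sum_compl_iterate_thickening_le hK hx hs k
    have h2 := Finset.sum_add_sum_compl B fun y => heatKernel K s x y
    rw [(heatKernel_mem_stdSimplex hK hs x).2] at h2
    have h3 : Real.exp (2 * s - k) ≤ Real.exp (-s) := Real.exp_le_exp.2 (by linarith)
    simp only [heatMatrix_apply]
    linarith
  have hin : ∑ x ∈ A, μ x * (1 - Real.exp (-s)) ≤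
      ∑ y ∈ B, Matrix.vecMul μ (heatMatrix K s) y := by
    simp only [Matrix.vecMul, dotProduct]
    rw [Finset.sum_comm]
    simp only [← Finset.mul_sum]
    calc ∑ x ∈ A, μ x * (1 - Real.exp (-s)) ≤ ∑ x ∈ A, μ x * ∑ y ∈ B, heatMatrix K s x y :=
          Finset.sum_le_sum fun x hx => mul_le_mul_of_nonneg_left (hout x hx) (hμ.1 x)
      _ ≤ _ := Finset.sum_le_sum_of_subset_of_nonneg (Finset.subset_univ _) fun x _ _ =>
          mul_nonneg (hμ.1 x) (Finset.sum_nonneg fun y _ => hP.1 x y)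
  have hA1 : ∑ x ∈ A, μ x ≤ 1 := by
    rw [← hμ.2]
    exact Finset.sum_le_sum_of_subset_of_nonneg (Finset.subset_univ _) fun x _ _ => hμ.1 x
  have htv := sum_sub_sum_le_tvDist (μ := Matrix.vecMul μ (heatMatrix K s))
    ((sum_vecMul_heatMatrix hK μ s).trans hμ.2) hπ.1.2 B
  rw [← Finset.sum_mul] at hin
  nlinarith [mul_le_mul_of_nonneg_right hA1 (Real.exp_pos (-s)).le]

end Thickening

/-! ### Bounding the varentropy by tails of the density. -/

section VarentropyBound

theorem minEntry_le {K : Matrix X X ℝ} (hK : K ∈ Matrix.rowStochastic ℝ X) {x y : X}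
    (hxy : 0 < K x y) : minEntry K ≤ K x y := by
  refine csInf_le ⟨0, ?_⟩ ⟨x, y, hxy.ne', rfl⟩
  rintro r ⟨x', y', -, rfl⟩
  exact hK.1 x' y'

theorem minEntry_nonneg {K : Matrix X X ℝ} (hK : K ∈ Matrix.rowStochastic ℝ X) :
    0 ≤ minEntry K := by
  refine Real.sInf_nonneg ?_
  rintro r ⟨x', y', -, rfl⟩
  exact hK.1 x' y'

/-- Square the bound |x log x| < 1 at x = √u. -/
theorem mul_sq_log_le {u : ℝ} (hu : 0 < u) (hu1 : u ≤ 1) : u * Real.log u ^ 2 ≤ 4 := by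
  have h := Real.abs_log_mul_self_lt (√u) (Real.sqrt_pos.2 hu) (Real.sqrt_le_one.2 hu1)
  rw [Real.log_sqrt hu.le] at h
  have h2 := (sq_le_one_iff_abs_le_one _).2 h.le
  rw [mul_pow, Real.sq_sqrt hu.le] at h2
  nlinarith

/-- The varentropy is at most the second moment of `log (μ / π)`, to which the states with
`μ ≤ π` contribute at most a constant. -/
theorem varentropy_le_of_tail {Y : Type*} [Fintype Y] {μ π : Y → ℝ} (hμ : μ ∈ stdSimplex ℝ Y)
    (hπ : π ∈ stdSimplex ℝ Y) (hpos : ∀ x, 0 < π x) {a L θ : ℝ}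
    (hL : ∀ x, -Real.log (π x) ≤ L) (hθ : ∑ x with a < Real.log (μ x / π x), μ x ≤ θ) :
    varentropy μ π ≤ 4 + a ^ 2 + θ * L ^ 2 := by
  have h1 : varentropy μ π = ∑ x, μ x * Real.log (μ x / π x) ^ 2 - relEntropy μ π ^ 2 := by
    have h2 : ∀ x, μ x * (Real.log (μ x / π x) - relEntropy μ π) ^ 2 =
        μ x * Real.log (μ x / π x) ^ 2 - 2 * relEntropy μ π * (μ x * Real.log (μ x / π x)) +
          relEntropy μ π ^ 2 * μ x := fun x => by ring
    simp only [varentropy, h2, Finset.sum_add_distrib, Finset.sum_sub_distrib, ← Finset.mul_sum,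
      hμ.2]
    rw [← relEntropy]
    ring
  -- The three terms cover densities at most 1, log-densities in (0, a], and those beyond `a`, where
  -- μ ≤ 1 gives log(μ/π) ≤ -log π ≤ L.
  have h3 : ∑ x, μ x * Real.log (μ x / π x) ^ 2 ≤ ∑ x, (4 * π x + a ^ 2 * μ x +
      (if a < Real.log (μ x / π x) then μ x else 0) * L ^ 2) := by
    refine Finset.sum_le_sum fun x _ => ?_
    have hμx := hμ.1 x
    have hπx := hpos x
    have ht : 0 ≤ (if a < Real.log (μ x / π x) then μ x else 0) * L ^ 2 := by
      split_ifs <;> positivity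
    rcases hμx.eq_or_lt with h0 | h0
    · rw [← h0] at ht ⊢
      have := mul_nonneg (sq_nonneg a) hμx
      rw [zero_mul, mul_zero, add_zero]
      exact add_nonneg (by positivity) ht
    have hu : 0 < μ x / π x := div_pos h0 hπx
    rcases le_or_gt (μ x / π x) 1 with hu1 | hu1
    · have h4 := mul_le_mul_of_nonneg_left (mul_sq_log_le hu hu1) hπx.le
      rw [← mul_assoc, mul_div_cancel₀ _ hπx.ne'] at h4
      have := mul_nonneg (sq_nonneg a) hμx
      linarith
    have hg : 0 < Real.log (μ x / π x) := Real.log_pos hu1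
    split_ifs with hga
    · have hgL : Real.log (μ x / π x) ≤ L := by
        refine le_trans ?_ (hL x)
        rw [Real.log_div h0.ne' hπx.ne']
        have : μ x ≤ 1 := by
          rw [← hμ.2]
          exact Finset.single_le_sum (fun z _ => hμ.1 z) (Finset.mem_univ x)
        have := Real.log_nonpos hμx this
        linarith
      have h5 := mul_le_mul_of_nonneg_left (pow_le_pow_left₀ hg.le hgL 2) hμx
      have := mul_nonneg (sq_nonneg a) hμx
      linarith
    · have h5 := mul_le_mul_of_nonneg_left (pow_le_pow_left₀ hg.le (not_lt.1 hga) 2) hμx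
      linarith
  rw [Finset.sum_add_distrib, Finset.sum_add_distrib, ← Finset.mul_sum, ← Finset.mul_sum,
    ← Finset.sum_mul, ← Finset.sum_filter, hμ.2, hπ.2] at h3
  have h6 := mul_le_mul_of_nonneg_right hθ (sq_nonneg L)
  have h7 := sq_nonneg (relEntropy μ π)
  rw [h1]
  linarith

variable {K : Matrix X X ℝ}

/-- Start from the Dirac mass at `o`: were π(o) smaller, the states reachable in about 3t steps
would have too little π-mass for the chain to be mixed at time `t`. -/
theorem neg_log_stationary_le [Nonempty X] (hK : K ∈ Matrix.rowStochastic ℝ X)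
    (hirr : K.IsIrreducible) (hsymm : SymmetricSupport K) {δ : ℝ} (hδ : 0 < δ)
    (hKδ : ∀ x y, 0 < K x y → δ ≤ K x y) {t ε : ℝ} (ht : 0 ≤ t) (hε : ε < 1)
    (htv : worstTV K t ≤ ε) (htε : Real.log (2 / (1 - ε)) ≤ t) (o : X) :
    -Real.log (stationary K o) ≤ Real.log (1 + 1 / δ ^ 2) * (3 * t + 1) + t := by
  have hε' : 0 < 1 - ε := by linarith
  have hμ : (Pi.single o 1 : X → ℝ) ∈ stdSimplex ℝ X := single_mem_stdSimplex ℝ o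
  have h := sum_sub_le_tvDist_vecMul_heatMatrix hK hsymm hδ hKδ hμ {o} ht
  rw [vecMul_single_heatMatrix, Finset.sum_singleton, Finset.sum_singleton, Pi.single_eq_same] at h
  have h1 := h.trans ((tvDist_heatKernel_le_worstTV K t o).trans htv)
  have h2 : Real.exp (-t) ≤ (1 - ε) / 2 := by
    have := (Real.log_le_iff_le_exp (by positivity)).1 htε
    rw [Real.exp_neg, inv_le_comm₀ (Real.exp_pos t) (by positivity), inv_div]
    exact this
  have h3 : Real.exp (-t) ≤
      Real.exp (Real.log (1 + 1 / δ ^ 2) * (3 * t + 1)) * stationary K o := by linarith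
  have h4 : Real.exp (-(Real.log (1 + 1 / δ ^ 2) * (3 * t + 1) + t)) ≤ stationary K o := by
    rw [neg_add, Real.exp_add, Real.exp_neg, ← div_eq_inv_mul, div_le_iff₀ (Real.exp_pos _),
      mul_comm]
    exact h3
  have := (Real.le_log_iff_exp_le (stationary_pos hK hirr o)).2 h4
  linarith

/-- If the chain is close to equilibrium at time `t + s`, then its density at time `t` is rarely
large. -/
theorem sum_filter_lt_log_le [Nonempty X] (hK : K ∈ Matrix.rowStochastic ℝ X)
    (hirr : K.IsIrreducible) (hsymm : SymmetricSupport K) {δ : ℝ} (hδ : 0 < δ)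
    (hKδ : ∀ x y, 0 < K x y → δ ≤ K x y) {t s a : ℝ} (ht : 0 ≤ t) (hs : 0 ≤ s) (ha : 0 ≤ a)
    (o : X) :
    ∑ x with a < Real.log (heatKernel K t o x / stationary K x), heatKernel K t o x ≤
      worstTV K (t + s) + Real.exp (-s) +
        Real.exp (Real.log (1 + 1 / δ ^ 2) * (3 * s + 1) - a) := by
  have hμ := heatKernel_mem_stdSimplex hK ht o
  have h := sum_sub_le_tvDist_vecMul_heatMatrix hK hsymm hδ hKδ hμ
    (Finset.univ.filter fun x => a < Real.log (heatKernel K t o x / stationary K x)) hs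
  rw [vecMul_heatKernel_heatMatrix] at h
  have h1 := tvDist_heatKernel_le_worstTV K (t + s) o
  -- On this set π is at most e^{-a} times the law at time `t`, so it is a π-small set to which the
  -- slow-escape bound applies.
  have h2 : ∑ x with a < Real.log (heatKernel K t o x / stationary K x), stationary K x ≤
      Real.exp (-a) := by
    calc _ ≤ ∑ x with a < Real.log (heatKernel K t o x / stationary K x),
          Real.exp (-a) * heatKernel K t o x := by
          refine Finset.sum_le_sum fun x hx => ?_
          have hgt := (Finset.mem_filter.1 hx).2
          have hpos := stationary_pos hK hirr x
          have hu : 0 < heatKernel K t o x / stationary K x := by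
            refine (div_nonneg (hμ.1 x) hpos.le).lt_of_ne fun h0 => ?_
            rw [← h0, Real.log_zero] at hgt
            linarith
          have := (Real.lt_log_iff_exp_lt hu).1 hgt
          rw [lt_div_iff₀ hpos] at this
          rw [Real.exp_neg, ← div_eq_inv_mul, le_div_iff₀ (Real.exp_pos a)]
          linarith
      _ ≤ ∑ x, Real.exp (-a) * heatKernel K t o x :=
          Finset.sum_le_sum_of_subset_of_nonneg (Finset.filter_subset _ _) fun x _ _ =>
            mul_nonneg (Real.exp_pos _).le (hμ.1 x)
      _ = Real.exp (-a) := by rw [← Finset.mul_sum, hμ.2, mul_one]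
  have h3 := mul_le_mul_of_nonneg_left h2
    (Real.exp_pos (Real.log (1 + 1 / δ ^ 2) * (3 * s + 1))).le
  rw [sub_eq_add_neg (_ * _), Real.exp_add]
  linarith

end VarentropyBound

end MarkovCutoff

namespace MarkovCutoff

/-! ### Asymptotics along a sequence of chains. -/

section Sequences

variable {X : ℕ → Type*} [∀ n, Fintype (X n)] [∀ n, DecidableEq (X n)] [∀ n, Nontrivial (X n)]
  {K : ∀ n, Matrix (X n) (X n) ℝ}

theorem hasCutoff_of_varentropyCriterion (hK : ∀ n, K n ∈ Matrix.rowStochastic ℝ (X n))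
    (hirr : ∀ n, (K n).IsIrreducible) (hγ : ∀ n, 0 < poincareConst (K n))
    (h : VarentropyCriterion K) : HasCutoff K := by
  intro ε hε ε' hε'
  -- Both mixing times then lie between those at levels 1 - κ and κ, so the window bound controls
  -- their ratio from both sides.
  obtain ⟨κ, hκ, hκ1, hκε, hκε', hκ1ε, hκ1ε'⟩ : ∃ κ : ℝ, 0 < κ ∧ κ < 1 ∧ κ ≤ ε ∧ κ ≤ ε' ∧
      ε ≤ 1 - κ ∧ ε' ≤ 1 - κ := by
    refine ⟨min (min ε ε') (min (1 - ε) (1 - ε')), ?_, ?_, ?_, ?_, ?_, ?_⟩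
    · exact lt_min (lt_min hε.1 hε'.1) (lt_min (sub_pos.2 hε.2) (sub_pos.2 hε'.2))
    · exact (min_le_left _ _).trans_lt ((min_le_left _ _).trans_lt hε.2)
    · exact (min_le_left _ _).trans (min_le_left _ _)
    · exact (min_le_left _ _).trans (min_le_right _ _)
    · have := (min_le_right (min ε ε') (min (1 - ε) (1 - ε'))).trans (min_le_left _ _)
      linarith
    · have := (min_le_right (min ε ε') (min (1 - ε) (1 - ε'))).trans (min_le_right _ _)
      linarith
  set C := √(2 / κ) + 2 * Real.log (2 / κ) with hC
  set q : ℕ → ℝ := fun n => poincareConst (K n) * mixingTime (K n) (1 - κ) /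
    (1 + √(worstVarentropy (K n) (mixingTime (K n) (1 - κ)))) with hq
  have hqlim : Tendsto q atTop atTop := h (1 - κ) ⟨by linarith, by linarith⟩
  have hup : Tendsto (fun n => 1 + C / q n) atTop (𝓝 1) := by
    simpa using (hqlim.const_div_atTop C).const_add 1
  have hlow : Tendsto (fun n => (1 + C / q n)⁻¹) atTop (𝓝 1) := by
    simpa using hup.inv₀ one_ne_zero
  have hkey : ∀ᶠ n in atTop, 0 < mixingTime (K n) (1 - κ) ∧
      mixingTime (K n) κ ≤ mixingTime (K n) (1 - κ) * (1 + C / q n) := by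
    filter_upwards [hqlim.eventually_gt_atTop 0] with n hn
    have hw : 0 < 1 + √(worstVarentropy (K n) (mixingTime (K n) (1 - κ))) := by positivity
    have hT : 0 < mixingTime (K n) (1 - κ) := by
      refine (mixingTime_nonneg _ _).lt_of_ne fun h0 => ?_
      simp only [hq] at hn
      rw [← h0] at hn
      simp at hn
    refine ⟨hT, (mixingTime_le_mixingTime_add (hK n) (hirr n) (hγ n) hκ hκ1).trans_eq ?_⟩
    have := (hγ n).ne'
    have := hT.ne'
    have := hw.ne'
    simp only [hq]
    rw [← hC]
    field_simp
  refine tendsto_of_tendsto_of_tendsto_of_le_of_le' hlow hup ?_ ?_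
  · filter_upwards [hkey] with n ⟨hT, hn⟩
    have h1 := mixingTime_anti (hK n) (hirr n) (hγ n) hε.1 hκ1ε
    have h2 := mixingTime_anti (hK n) (hirr n) (hγ n) hκ hκε
    have h3 := mixingTime_anti (hK n) (hirr n) (hγ n) hε'.1 hκ1ε'
    have hpos : 0 < 1 + C / q n := pos_of_mul_pos_right (by linarith) hT.le
    rw [le_div_iff₀ (by linarith), inv_mul_le_iff₀ hpos]
    nlinarith
  · filter_upwards [hkey] with n ⟨hT, hn⟩
    have h1 := mixingTime_anti (hK n) (hirr n) (hγ n) hε.1 hκ1ε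
    have h2 := mixingTime_anti (hK n) (hirr n) (hγ n) hκ hκε'
    have hpos : 0 < 1 + C / q n := pos_of_mul_pos_right (by
      linarith [mixingTime_anti (hK n) (hirr n) (hγ n) hκ hκε]) hT.le
    rw [div_le_iff₀ (by linarith)]
    nlinarith

theorem tendsto_mixingTime_of_hasCutoff (hK : ∀ n, K n ∈ Matrix.rowStochastic ℝ (X n))
    (hirr : ∀ n, (K n).IsIrreducible) (hγ : ∀ n, 0 < poincareConst (K n)) (h : HasCutoff K)
    {ε : ℝ} (hε : ε ∈ Set.Ioo (0 : ℝ) 1) : Tendsto (fun n => mixingTime (K n) ε) atTop atTop := by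
  refine tendsto_atTop.2 fun M => ?_
  -- At this level every mixing time is at least 2|M|, so a ratio below 2 forces the one at level ε
  -- above |M|.
  set ε' := Real.exp (-(4 * |M|)) / 2 with hε'
  have h1 : 0 < ε' := by positivity
  have h2 : ε' < 1 := by
    have : Real.exp (-(4 * |M|)) ≤ 1 := Real.exp_le_one_iff.2 (by linarith [abs_nonneg M])
    linarith
  have hlim := h ε hε ε' ⟨h1, h2⟩
  filter_upwards [hlim.eventually_lt_const (show (1 : ℝ) < 2 by norm_num),
    hlim.eventually_const_lt (show (0 : ℝ) < 1 by norm_num)] with n hn hn0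
  have hT : 0 < mixingTime (K n) ε := by
    -- A zero denominator would give ratio 0 by convention, contradicting its positivity.
    refine (mixingTime_nonneg _ _).lt_of_ne fun h0 => ?_
    rw [← h0, div_zero] at hn0
    exact lt_irrefl _ hn0
  rw [div_lt_iff₀ hT] at hn
  have h3 := log_le_mixingTime (hK n) (hirr n) (hγ n) h1
  rw [hε', mul_div_cancel₀ _ two_ne_zero, Real.log_exp, ← hε'] at h3
  linarith [le_abs_self M]

/-- Under cutoff, the varentropy at the mixing time is negligible compared to the square of the
mixing time. -/
theorem eventually_worstVarentropy_le (hK : ∀ n, K n ∈ Matrix.rowStochastic ℝ (X n))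
    (hirr : ∀ n, (K n).IsIrreducible) (hsymm : ∀ n, SymmetricSupport (K n))
    (hγ : ∀ n, 0 < poincareConst (K n)) {δ : ℝ} (hδ : 0 < δ)
    (hKδ : ∀ n x y, 0 < K n x y → δ ≤ K n x y) (h : HasCutoff K)
    {ε : ℝ} (hε : ε ∈ Set.Ioo (0 : ℝ) 1) {κ : ℝ} (hκ : 0 < κ) :
    ∀ᶠ n in atTop, worstVarentropy (K n) (mixingTime (K n) ε) ≤ (κ * mixingTime (K n) ε) ^ 2 := by
  set c := Real.log (1 + 1 / δ ^ 2) with hc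
  have hc0 : 0 ≤ c := Real.log_nonneg (by
    have : 0 ≤ 1 / δ ^ 2 := by positivity
    linarith)
  -- For t ≥ 1, c(3t + 1) + t ≤ Lt bounds -log π. The choices of η and θ make (ηt)² and θ(Lt)² each
  -- equal to (κt)²/4, and κt ≥ 4 absorbs the additive 4. The bound 3cρ ≤ η/2 keeps set growth
  -- during time ρt below the density threshold e^{ηt}.
  set L := 4 * c + 1 with hL
  have hL0 : 0 < L := by positivity
  set η := κ / 2 with hη
  have hη0 : 0 < η := by positivity
  set θ := κ ^ 2 / (4 * L ^ 2) with hθ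
  have hθ0 : 0 < θ := by positivity
  set ρ := η / (6 * c + 1) with hρ
  have hρ0 : 0 < ρ := by positivity
  have hρη : 3 * c * ρ ≤ η / 2 := by
    have h1 : ρ * (6 * c + 1) = η := div_mul_cancel₀ _ (by positivity)
    nlinarith
  set ε' := min (θ / 3) (1 / 2) with hε'
  have hε'0 : 0 < ε' := lt_min (by positivity) (by norm_num)
  have hε'1 : ε' < 1 := (min_le_right _ _).trans_lt (by norm_num)
  have hT := tendsto_mixingTime_of_hasCutoff hK hirr hγ h hε
  have hlim := h ε hε ε' ⟨hε'0, hε'1⟩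
  have hE1 : Tendsto (fun n => Real.exp (-(ρ * mixingTime (K n) ε))) atTop (𝓝 0) :=
    Real.tendsto_exp_neg_atTop_nhds_zero.comp (hT.const_mul_atTop hρ0)
  have hE2 : Tendsto (fun n => Real.exp (-(η / 2 * mixingTime (K n) ε - c))) atTop (𝓝 0) :=
    Real.tendsto_exp_neg_atTop_nhds_zero.comp
      (tendsto_atTop_add_const_right _ (-c) (hT.const_mul_atTop (half_pos hη0)))
  filter_upwards [hT.eventually_ge_atTop 1, hT.eventually_ge_atTop (Real.log (2 / (1 - ε))),
    hT.eventually_ge_atTop (4 / κ), hlim.eventually_le_const (show (1 : ℝ) < 1 + ρ by linarith),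
    hE1.eventually_le_const (show 0 < θ / 3 by positivity),
    hE2.eventually_le_const (show 0 < θ / 3 by positivity)] with n h1 h2 h3 h4 h5 h6
  set t := mixingTime (K n) ε with ht
  have ht0 : 0 < t := by linarith
  rw [div_le_iff₀ ht0] at h4
  -- Cutoff enters here: the mixing time at the much smaller level ε' is at most (1 + ρ)t. The other
  -- two tail terms vanish as t grows.
  have htv : worstTV (K n) (t + ρ * t) ≤ θ / 3 := by
    refine (worstTV_anti (hK n) (s := mixingTime (K n) ε') (by linarith)).trans
      ((worstTV_mixingTime_le (hK n) (hirr n) (hγ n) hε'0).trans (min_le_left _ _))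
  refine ciSup_le fun o => ?_
  have htail := sum_filter_lt_log_le (hK n) (hirr n) (hsymm n) hδ (hKδ n) ht0.le
    (mul_nonneg hρ0.le ht0.le) (mul_nonneg hη0.le ht0.le) o
  have h7 : Real.exp (c * (3 * (ρ * t) + 1) - η * t) ≤ Real.exp (-(η / 2 * t - c)) := by
    refine Real.exp_le_exp.2 ?_
    nlinarith [mul_le_mul_of_nonneg_right hρη ht0.le]
  have hlog : ∀ x, -Real.log (stationary (K n) x) ≤ L * t := fun x => by
    have h8 := neg_log_stationary_le (hK n) (hirr n) (hsymm n) hδ (hKδ n) ht0.le hε.2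
      (worstTV_mixingTime_le (hK n) (hirr n) (hγ n) hε.1) h2 x
    have h9 : c * 1 ≤ c * t := mul_le_mul_of_nonneg_left h1 hc0
    rw [hL]
    linarith
  have hV := varentropy_le_of_tail (heatKernel_mem_stdSimplex (hK n) ht0.le o)
    (stationary_spec (hK n)).1 (stationary_pos (hK n) (hirr n)) hlog
    (show _ ≤ θ by linarith)
  have h10 : θ * (L * t) ^ 2 = (κ * t) ^ 2 / 4 := by
    rw [hθ]
    field_simp
  have h11 : (η * t) ^ 2 = (κ * t) ^ 2 / 4 := by
    rw [hη]
    ring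
  have h12 : 4 ≤ κ * t := by
    rw [div_le_iff₀ hκ] at h3
    linarith
  nlinarith

theorem varentropyCriterion_of_hasCutoff (hK : ∀ n, K n ∈ Matrix.rowStochastic ℝ (X n))
    (hirr : ∀ n, (K n).IsIrreducible) (hsymm : ∀ n, SymmetricSupport (K n))
    {γ : ℝ} (hγ : 0 < γ) (hKγ : ∀ n, γ ≤ poincareConst (K n)) {δ : ℝ} (hδ : 0 < δ)
    (hKδ : ∀ n x y, 0 < K n x y → δ ≤ K n x y) (h : HasCutoff K) : VarentropyCriterion K := by
  intro ε hε
  have hKγ0 : ∀ n, 0 < poincareConst (K n) := fun n => hγ.trans_le (hKγ n)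
  refine tendsto_atTop.2 fun M => ?_
  -- Eventually 1 and √V are both at most κt, so (|M| + 1)(1 + √V) ≤ γt. The uniform lower bound on
  -- the Poincaré constants lets κ be independent of `n`.
  set κ := γ / (2 * (|M| + 1)) with hκ
  have hM : 0 < |M| + 1 := by positivity
  have hκ0 : 0 < κ := by positivity
  have hT := tendsto_mixingTime_of_hasCutoff hK hirr hKγ0 h hε
  filter_upwards [eventually_worstVarentropy_le hK hirr hsymm hKγ0 hδ hKδ h hε hκ0,
    hT.eventually_ge_atTop (1 / κ)] with n h1 h2
  set t := mixingTime (K n) ε with ht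
  have ht0 : 0 ≤ t := mixingTime_nonneg _ _
  have h3 : √(worstVarentropy (K n) t) ≤ κ * t := Real.sqrt_le_iff.2 ⟨by positivity, h1⟩
  rw [div_le_iff₀ hκ0] at h2
  have h4 : (|M| + 1) * (2 * κ) = γ := by
    rw [hκ]
    field_simp
  rw [le_div_iff₀ (by positivity)]
  calc M * (1 + √(worstVarentropy (K n) t)) ≤ (|M| + 1) * (1 + √(worstVarentropy (K n) t)) :=
        mul_le_mul_of_nonneg_right (by linarith [le_abs_self M]) (by positivity)
    _ ≤ (|M| + 1) * (2 * (κ * t)) := mul_le_mul_of_nonneg_left (by linarith) hM.le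
    _ = γ * t := by rw [← h4]; ring
    _ ≤ poincareConst (K n) * t := mul_le_mul_of_nonneg_right (hKγ n) ht0

end Sequences

end MarkovCutoff

theorem theorem2 {X : ℕ → Type*} [∀ n, Fintype (X n)] [∀ n, DecidableEq (X n)]
    [∀ n, Nontrivial (X n)]
    (K : ∀ n, Matrix (X n) (X n) ℝ)
    (hstoch : ∀ n, K n ∈ Matrix.rowStochastic ℝ (X n))
    (hirr : ∀ n, (K n).IsIrreducible)
    (hsymm : ∀ n, MarkovCutoff.SymmetricSupport (K n))
    (hsparse : 0 < ⨅ n, MarkovCutoff.minEntry (K n))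
    (hexpand : 0 < ⨅ n, MarkovCutoff.poincareConst (K n)) :
    MarkovCutoff.HasCutoff K ↔ MarkovCutoff.VarentropyCriterion K := by
  have hδle : ∀ n, ⨅ n, MarkovCutoff.minEntry (K n) ≤ MarkovCutoff.minEntry (K n) :=
    ciInf_le ⟨0, Set.forall_mem_range.2 fun n => MarkovCutoff.minEntry_nonneg (hstoch n)⟩
  have hγle : ∀ n, ⨅ n, MarkovCutoff.poincareConst (K n) ≤ MarkovCutoff.poincareConst (K n) :=
    ciInf_le ⟨0, Set.forall_mem_range.2 fun n => MarkovCutoff.poincareConst_nonneg (hstoch n)⟩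
  exact ⟨MarkovCutoff.varentropyCriterion_of_hasCutoff hstoch hirr hsymm hexpand hγle hsparse
      fun n _ _ hxy => (hδle n).trans (MarkovCutoff.minEntry_le (hstoch n) hxy),
    MarkovCutoff.hasCutoff_of_varentropyCriterion hstoch hirr fun n => hexpand.trans_le (hγle n)⟩
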